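/- **Setting (kick-model of a twisting somersault).** A diver moves one arm in the $yz$-plane of the body frame; the arm angle is $\alpha\in[0,\pi]$ ($\alpha=\pi$ up, $\alpha=0$ down). The tensor of inertia $I(\alpha)$ is symmetric positive definite, continuous in $\alpha$, with $I_{xy}=I_{xz}=0$, and the moving arm generates the internal angular momentum $\mathbf A=(A_x(\alpha)\dot\alpha,0,0)^t$ with $A_x$ continuous. Put $I_s=I(\pi)$, $I_t=I(0)$, and assume that the $y$-axis is a principal axis of $I_s$. Let $R_x(\theta)$ be the rotation by $\theta$ about the $x$-axis and write $I_t=R_x(\mathcal P)\,\mathrm{diag}(J_x,J_y,J_z)\,R_x(-\mathcal P)$. For $l>0$ put $$\chi=\int_0^\pi (I(\alpha)^{-1})_{xx}A_x(\alpha)\,d\alpha,\quad L_s=(0,l,0)^t,\quad L_t=R_x(-\chi)L_s,\quad E_s=\tfrac12 L_s\cdot I_s^{-1}L_s,\quad E_t=\tfrac12 L_t\cdot I_t^{-1}L_t .$$ Assume that $J_z<J_x$ and $J_z<J_y$, that $E_t>l^2/(2J_x)$ and $E_t>l^2/(2J_y)$ (so that the orbit of $L_t$ encircles the principal axis $p=R_x(\mathcal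 P)e_z$, the twist axis), and that $|\chi+\mathcal P|<\pi/2$. Let $T_t$ be the least period of the solution of the Euler equations $\dot L=L\times I_t^{-1}L$ with $L(0)=L_t$, and let $S$ be the solid angle of the part of the sphere $|L|=l$ between the equator orthogonal to $p$ and this orbit. A dive has constant angular momentum $\boldsymbol\ell=RL$ in space, $|\boldsymbol\ell|=l$, where $R(t)\in SO(3)$ is the orientation, and consists of: stage 1, rigid motion with tensor $I_s$ for a time $\tau_1\ge0$, starting with $L=L_s$; an instantaneous kick moving the arm down; stage 3, rigid motion with tensor $I_t$ for a time $\tau_3\ge0$; an instantaneous kick moving the arm up; stage 5, rigid motion with tensor $I_s$ for a time $\tau_5\ge0$. In rigid stages the body angular velocity is $\Omega=I^{-1}L$; in a kick it is $\Omega=-I^{-1}\mathbf A$. The airborne time is $T_{air}=\tau_1+\tau_3+\tau_5$. The dive has $n\in\{0,1,2,\dots\}$ twists if in stage 3 the body-frame angular momentum $L$ makes $n$ full revolutions about $p$. It has $m\in\mathbb R$ somersaults if the azimuth about $\boldsymbol\ell$ of the twist axis ($Re_z$ in stages 1 and 5, $Rp$ in stage 3), followed continuously through the dive, changes by $2\pi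 m$ in total. **Statement.** Every such dive with $m$ somersaults and $n$ twists satisfies $$2\pi m+nS=T_{air}\,\frac{2E_s}{l}+2n\,l\,T_t\,\frac{E_t-E_s}{l^2},$$ where $\tau_3=nT_t$ and $T_{air}-\tau_3=\tau_1+\tau_5\ge0$. -/

import Mathlib

open Set MeasureTheory
open scoped Matrix

namespace TwistingSomersault

noncomputable section

/-- Rotation of `ℝ³` by the angle `θ` about the `x`-axis. -/
def rotX (θ : ℝ) : Matrix (Fin 3) (Fin 3) ℝ :=
  !![1, 0, 0; 0, Real.cos θ, -Real.sin θ; 0, Real.sin θ, Real.cos θ]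

/-- The kinetic energy `½ L · I⁻¹ L` of a rigid body with tensor of inertia `I` and angular
momentum `L`, both in the body frame. -/
def energy (I : Matrix (Fin 3) (Fin 3) ℝ) (L : Fin 3 → ℝ) : ℝ :=
  (1 / 2) * (L ⬝ᵥ (I⁻¹ *ᵥ L))

/-- `R` is, on the time interval `[a, b]`, the orientation of a freely rotating rigid body with
tensor of inertia `I` and space-fixed angular momentum `ℓ`: `R` takes values in `SO(3)`, the
angular momentum in the body frame is `L = Rᵀ ℓ`, and the body angular velocity `Ω`, for which
`R' v = R (Ω × v)`, is `Ω = I⁻¹ L`. -/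
def IsRigidMotion (I : Matrix (Fin 3) (Fin 3) ℝ) (ℓ : Fin 3 → ℝ) (a b : ℝ)
    (R : ℝ → Matrix (Fin 3) (Fin 3) ℝ) : Prop :=
  ∀ t ∈ Icc a b, R t ∈ Matrix.specialOrthogonalGroup (Fin 3) ℝ ∧
    ∀ v : Fin 3 → ℝ, HasDerivWithinAt (fun s => R s *ᵥ v)
      (R t *ᵥ (crossProduct (I⁻¹ *ᵥ ((R t)ᵀ *ᵥ ℓ)) v)) (Icc a b) t

/-- `Λ` is a solution, for all time, of the Euler equations `L' = L × I⁻¹ L`. -/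
def IsEulerSolution (I : Matrix (Fin 3) (Fin 3) ℝ) (Λ : ℝ → Fin 3 → ℝ) : Prop :=
  ∀ t, HasDerivAt Λ (crossProduct (Λ t) (I⁻¹ *ᵥ Λ t)) t

/-- The (least) period of the solution of the Euler equations that starts at `L₀`. -/
def eulerPeriod (I : Matrix (Fin 3) (Fin 3) ℝ) (L₀ : Fin 3 → ℝ) : ℝ :=
  sInf {T : ℝ | 0 < T ∧
    ∃ Λ : ℝ → Fin 3 → ℝ, IsEulerSolution I Λ ∧ Λ 0 = L₀ ∧ Function.Periodic Λ T}

/-- For the orbit of the Euler equations through `L₀` on the sphere `|L| = l`, encircling the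
axis `p`: the solid angle of the part of the sphere between the equator orthogonal to `p` and the
orbit.  This is the surface area of the set of all unit vectors `u` that lie in the same open
hemisphere as the orbit and for which `l u` is on the equatorial side of the energy surface. -/
def orbitSolidAngle (I : Matrix (Fin 3) (Fin 3) ℝ) (p : Fin 3 → ℝ) (l : ℝ)
    (L₀ : Fin 3 → ℝ) : ℝ :=
  ((volume : Measure (EuclideanSpace ℝ (Fin 3))).toSphere
    {u | 0 < (L₀ ⬝ᵥ p) * (WithLp.ofLp u.1 ⬝ᵥ p) ∧
      energy I (l • WithLp.ofLp u.1) ≤ energy I L₀}).toReal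

/-- The vector `v` is off the line of the unit vector `axis`, and its azimuth about `axis`, counted
counterclockwise from the unit vector `ref` orthogonal to `axis`, is `θ` modulo `2π`. -/
def IsAzimuth (axis ref v : Fin 3 → ℝ) (θ : ℝ) : Prop :=
  ∃ r : ℝ, 0 < r ∧ v ⬝ᵥ ref = r * Real.cos θ ∧
    v ⬝ᵥ (crossProduct axis ref) = r * Real.sin θ

/-- A diver whose shape depends on one angle `α ∈ [0, π]`, the angle of an arm that moves in the
`yz`-plane of the body frame (`α = π`: arm up, `α = 0`: arm down).  `inertia α` is the tensor of
inertia and `(shift α * α', 0, 0)` the internal angular momentum of the moving arm.  With the arm up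
the `y`-axis, the axis of the somersault, is a principal axis. -/
structure ArmDiver where
  inertia : ℝ → Matrix (Fin 3) (Fin 3) ℝ
  shift : ℝ → ℝ
  inertia_continuousOn : ∀ i j, ContinuousOn (fun α => inertia α i j) (Icc 0 Real.pi)
  shift_continuousOn : ContinuousOn shift (Icc 0 Real.pi)
  inertia_posDef : ∀ α ∈ Icc 0 Real.pi, (inertia α).PosDef
  inertia_xy : ∀ α ∈ Icc 0 Real.pi, inertia α 0 1 = 0
  inertia_xz : ∀ α ∈ Icc 0 Real.pi, inertia α 0 2 = 0
  inertia_somersault_yz : inertia Real.pi 1 2 = 0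

namespace ArmDiver

/-- Tensor of inertia in the somersault stages (arm up). -/
def Is (D : ArmDiver) : Matrix (Fin 3) (Fin 3) ℝ := D.inertia Real.pi

/-- Tensor of inertia in the twisting stage (arm down). -/
def It (D : ArmDiver) : Matrix (Fin 3) (Fin 3) ℝ := D.inertia 0

/-- The tilt angle. -/
def tilt (D : ArmDiver) : ℝ := ∫ α in (0 : ℝ)..Real.pi, ((D.inertia α)⁻¹ 0 0) * D.shift α

/-- Angular momentum of pure somersault, in the body frame. -/
def Ls (_D : ArmDiver) (l : ℝ) : Fin 3 → ℝ := ![0, l, 0]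

/-- Angular momentum, in the body frame, right after the kick that moves the arm down. -/
def Lt (D : ArmDiver) (l : ℝ) : Fin 3 → ℝ := rotX (-D.tilt) *ᵥ D.Ls l

/-- Energy in the somersault stages. -/
def Es (D : ArmDiver) (l : ℝ) : ℝ := energy D.Is (D.Ls l)

/-- Energy in the twisting stage. -/
def Et (D : ArmDiver) (l : ℝ) : ℝ := energy D.It (D.Lt l)

/-- Period of the periodic orbit of the twisting stage. -/
def Tt (D : ArmDiver) (l : ℝ) : ℝ := eulerPeriod D.It (D.Lt l)

/-- `J = (J_x, J_y, J_z)` are the principal moments of inertia in the twisting stage, and the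
rotation by `P` about the `x`-axis takes the coordinate axes to the principal axes. -/
def IsPrincipal (D : ArmDiver) (P : ℝ) (J : Fin 3 → ℝ) : Prop :=
  D.It = rotX P * Matrix.diagonal J * rotX (-P)

/-- Solid angle between the equator orthogonal to the twist axis `rotX P e_z` and the orbit of the
twisting stage. -/
def S (D : ArmDiver) (P l : ℝ) : ℝ := orbitSolidAngle D.It (rotX P *ᵥ ![0, 0, 1]) l (D.Lt l)

/-- The orientation during an impulsive motion of the arm, as a function of the arm angle.  In a kick
the internal angular momentum `A` dominates, so that the equation of motion is `R' v = R (Ω × v)`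
with `Ω = -I⁻¹ A`; it does not change under reparametrisation of time, so that the arm angle serves
as the independent variable. -/
def IsKick (D : ArmDiver) (K : ℝ → Matrix (Fin 3) (Fin 3) ℝ) : Prop :=
  ∀ α ∈ Icc 0 Real.pi, K α ∈ Matrix.specialOrthogonalGroup (Fin 3) ℝ ∧
    ∀ v : Fin 3 → ℝ, HasDerivWithinAt (fun β => K β *ᵥ v)
      (K α *ᵥ (crossProduct (-((D.inertia α)⁻¹ *ᵥ ![D.shift α, 0, 0])) v)) (Icc 0 Real.pi) α

end ArmDiver

/-- A dive in the kick-model, with angular momentum of magnitude `l`: pure somersault with the arm up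
for a time `τ₁`, a kick that moves the arm down, rigid motion with the arm down for a time `τ₃`, a
kick that moves the arm up, and rigid motion with the arm up for a time `τ₅`.  The kicks take no
time. -/
structure KickDive (D : ArmDiver) (l : ℝ) where
  /-- the angular momentum in the space-fixed frame -/
  ℓ : Fin 3 → ℝ
  τ₁ : ℝ
  τ₃ : ℝ
  τ₅ : ℝ
  τ₁_nonneg : 0 ≤ τ₁
  τ₃_nonneg : 0 ≤ τ₃
  τ₅_nonneg : 0 ≤ τ₅
  /-- orientations of the body in stages 1, 3, 5 (functions of time) and in the two kicks, that is
  in stages 2, 4 (functions of the arm angle) -/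
  R₁ : ℝ → Matrix (Fin 3) (Fin 3) ℝ
  K₂ : ℝ → Matrix (Fin 3) (Fin 3) ℝ
  R₃ : ℝ → Matrix (Fin 3) (Fin 3) ℝ
  K₄ : ℝ → Matrix (Fin 3) (Fin 3) ℝ
  R₅ : ℝ → Matrix (Fin 3) (Fin 3) ℝ
  start : (R₁ 0)ᵀ *ᵥ ℓ = D.Ls l
  stage₁ : IsRigidMotion D.Is ℓ 0 τ₁ R₁
  stage₂ : D.IsKick K₂
  stage₃ : IsRigidMotion D.It ℓ τ₁ (τ₁ + τ₃) R₃
  stage₄ : D.IsKick K₄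
  stage₅ : IsRigidMotion D.Is ℓ (τ₁ + τ₃) (τ₁ + τ₃ + τ₅) R₅
  glue₁₂ : K₂ Real.pi = R₁ τ₁
  glue₂₃ : R₃ τ₁ = K₂ 0
  glue₃₄ : K₄ 0 = R₃ (τ₁ + τ₃)
  glue₄₅ : R₅ (τ₁ + τ₃) = K₄ Real.pi

namespace KickDive

variable {D : ArmDiver} {l : ℝ}

/-- The airborne time. -/
def Tair (d : KickDive D l) : ℝ := d.τ₁ + d.τ₃ + d.τ₅

/-- In stage 3 the dive performs `n` twists: in the body frame the angular momentum makes `n` full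
revolutions about the twist axis `rotX P e_z`, measured by a continuous choice `ψ` of its azimuth. -/
def HasTwists (d : KickDive D l) (P : ℝ) (n : ℕ) : Prop :=
  ∃ ψ : ℝ → ℝ, ContinuousOn ψ (Icc d.τ₁ (d.τ₁ + d.τ₃)) ∧
    (∀ t ∈ Icc d.τ₁ (d.τ₁ + d.τ₃),
      IsAzimuth (rotX P *ᵥ ![0, 0, 1]) (rotX P *ᵥ ![0, 1, 0]) ((d.R₃ t)ᵀ *ᵥ d.ℓ) (ψ t)) ∧
    |ψ (d.τ₁ + d.τ₃) - ψ d.τ₁| = 2 * Real.pi * n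

/-- The dive performs `m` somersaults: the twist axis (`e_z` in stages 1 and 5, `rotX P e_z` in
stage 3) turns in space by the total angle `2 π m` about the fixed angular momentum vector, measured
by a choice `φ` of its azimuth that is continuous during the whole dive. -/
def HasSomersaults (d : KickDive D l) (P : ℝ) (m : ℝ) : Prop :=
  ∃ φ : ℝ → ℝ, ContinuousOn φ (Icc 0 d.Tair) ∧
    (∀ t ∈ Icc 0 d.τ₁,
      IsAzimuth (l⁻¹ • d.ℓ) (d.R₁ 0 *ᵥ ![0, 0, 1]) (d.R₁ t *ᵥ ![0, 0, 1]) (φ t)) ∧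
    (∀ t ∈ Icc d.τ₁ (d.τ₁ + d.τ₃),
      IsAzimuth (l⁻¹ • d.ℓ) (d.R₁ 0 *ᵥ ![0, 0, 1])
        (d.R₃ t *ᵥ (rotX P *ᵥ ![0, 0, 1])) (φ t)) ∧
    (∀ t ∈ Icc (d.τ₁ + d.τ₃) d.Tair,
      IsAzimuth (l⁻¹ • d.ℓ) (d.R₁ 0 *ᵥ ![0, 0, 1]) (d.R₅ t *ᵥ ![0, 0, 1]) (φ t)) ∧
    φ d.Tair - φ 0 = 2 * Real.pi * m

end KickDive

end

end TwistingSomersault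

/-! The somersault angle is the integral of the azimuth rate of the twist axis about the angular
momentum `ℓ`, and this rate can be computed stage by stage.

With the arm up, `Ls` lies on a principal axis, so the body-frame momentum is an equilibrium of the
Euler equations and the rate is the constant `2 Es / l` (`somersault_stage`). A kick turns the body
about its `x`-axis by the tilt (`ArmDiver.IsKick.eq_mul_rotX`), so the first kick takes `Ls` to
`Lt`. After whole twists the momentum is `Lt` again, and the second kick takes it back to `Ls`.

With the arm down, conservation of norm and energy puts the momentum, in principal axes, on the
curve `a z² = b₁ x² + b₀ y²` of a sphere, with `a = 1/J_z - 2 Et/l²`, `b₁ = 2 Et/l² - 1/J_x`, `b₀ =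
2 Et/l² - 1/J_y`, all positive. The azimuth `ψ` of the momentum about the twist axis parametrises
this curve: with `f = orbitForm b₀ b₁ ψ`, the height on the unit sphere is `h = √f / √(a + f)`, and
`ψ' = -σ l √f √(a + f)`, where `σ = ±1` is the hemisphere. The rate of the twist axis about `ℓ` is
`2 Et / l - l f = 2 Et / l + σ h ψ'`: a dynamic phase plus a geometric one. Over `n` revolutions `ψ`
changes by `-2π n σ`, which contributes `-n ∫ h` (`twist_stage`). The integral of the height over
the azimuth is the area between equator and curve, hence `S` (`orbitSolidAngle_eq_integral`), and
the time of one revolution is the least period (`eulerPeriod_eq_orbitTime`). Adding the three stages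
gives the formula. -/

namespace TwistingSomersault

/-! ### Calculus on an interval, uniqueness of solutions, polar angles -/

theorem hasDerivWithinAt_Ici_of_Icc {E : Type*} [NormedAddCommGroup E] [NormedSpace ℝ E]
    {f : ℝ → E} {f' : E} {a b t : ℝ} (ht : t ∈ Ico a b)
    (h : HasDerivWithinAt f f' (Icc a b) t) : HasDerivWithinAt f f' (Ici t) t :=
  (h.mono (Icc_subset_Icc_left ht.1)).mono_of_mem_nhdsWithin (Icc_mem_nhdsGE ht.2)

/-- A function with vanishing derivative on `[a, b]` is constant there. -/
theorem eq_left_of_hasDerivWithinAt_zero {f : ℝ → ℝ} {a b : ℝ}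
    (h : ∀ t ∈ Icc a b, HasDerivWithinAt f 0 (Icc a b) t) : ∀ t ∈ Icc a b, f t = f a :=
  constant_of_has_deriv_right_zero (fun t ht => (h t ht).continuousWithinAt)
    fun t ht => hasDerivWithinAt_Ici_of_Icc ht (h t (Ico_subset_Icc_self ht))

/-- A function with constant derivative `ω` on `[a, b]` is affine there. -/
theorem sub_eq_of_hasDerivWithinAt_const {f : ℝ → ℝ} {a b ω : ℝ}
    (h : ∀ t ∈ Icc a b, HasDerivWithinAt f ω (Icc a b) t) :
    ∀ t ∈ Icc a b, f t - f a = ω * (t - a) := by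
  intro t ht
  have := eq_left_of_hasDerivWithinAt_zero (f := fun u => f u - ω * u) (a := a) (b := b)
    (fun u hu => by
      simpa using (h u hu).fun_sub (((hasDerivAt_id u).const_mul ω).hasDerivWithinAt)) t ht
  linarith

/-- Solutions of an autonomous equation with `C¹` right-hand side are unique. -/
theorem eqOn_of_autonomous_solutions {E : Type*} [NormedAddCommGroup E] [NormedSpace ℝ E]
    [FiniteDimensional ℝ E] {V : E → E} (hV : ContDiff ℝ 1 V) {f g : ℝ → E} {a b : ℝ}
    (hf : ∀ t ∈ Icc a b, HasDerivWithinAt f (V (f t)) (Icc a b) t)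
    (hg : ∀ t ∈ Icc a b, HasDerivWithinAt g (V (g t)) (Icc a b) t) (h₀ : f a = g a) :
    EqOn f g (Icc a b) := by
  have hfc : ContinuousOn f (Icc a b) := fun t ht => (hf t ht).continuousWithinAt
  have hgc : ContinuousOn g (Icc a b) := fun t ht => (hg t ht).continuousWithinAt
  have : ProperSpace E := FiniteDimensional.proper ℝ E
  -- Both trajectories are compact, so they stay in one closed ball, on which the `C¹` field is
  -- Lipschitz.
  obtain ⟨C, hC⟩ := ((isCompact_Icc.image_of_continuousOn hfc).union
    (isCompact_Icc.image_of_continuousOn hgc)).isBounded.subset_closedBall (0 : E)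
  obtain ⟨K, hK⟩ := LocallyLipschitzOn.exists_lipschitzOnWith_of_compact
    (isCompact_closedBall (0 : E) C) (hV.locallyLipschitz.locallyLipschitzOn)
  exact ODE_solution_unique_of_mem_Icc_right (v := fun _ => V) (s := fun _ => Metric.closedBall 0 C)
    (fun _ _ => hK) hfc
    (fun t ht => hasDerivWithinAt_Ici_of_Icc ht (hf t (Ico_subset_Icc_self ht)))
    (fun t ht => hC (Or.inl (mem_image_of_mem _ (Ico_subset_Icc_self ht)))) hgc
    (fun t ht => hasDerivWithinAt_Ici_of_Icc ht (hg t (Ico_subset_Icc_self ht)))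
    (fun t ht => hC (Or.inr (mem_image_of_mem _ (Ico_subset_Icc_self ht)))) h₀

/-- A continuous choice `φ` of the polar angle of a moving point `(x, y) ≠ 0` of the plane is
differentiable, with derivative `(x y' - y x') / (x² + y²)`. -/
theorem hasDerivWithinAt_polar_angle {s : Set ℝ} {x y r φ : ℝ → ℝ} {x' y' ω t : ℝ} (ht : t ∈ s)
    (hφ : ContinuousWithinAt φ s t) (hx : HasDerivWithinAt x x' s t)
    (hy : HasDerivWithinAt y y' s t) (hr : ∀ u ∈ s, 0 < r u)
    (hxr : ∀ u ∈ s, x u = r u * Real.cos (φ u)) (hyr : ∀ u ∈ s, y u = r u * Real.sin (φ u))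
    (hω : x t * y' - y t * x' = ω * (x t ^ 2 + y t ^ 2)) : HasDerivWithinAt φ ω s t := by
  -- Coordinates of the point in the frame turned by `φ t`: there the angle at time `t` is `0`, so
  -- `arctan (q / c)` is the right branch nearby.
  set c : ℝ → ℝ := fun u => x u * Real.cos (φ t) + y u * Real.sin (φ t) with hc
  set q : ℝ → ℝ := fun u => -(x u * Real.sin (φ t)) + y u * Real.cos (φ t) with hq
  have hcu : ∀ u ∈ s, c u = r u * Real.cos (φ u - φ t) := by
    intro u hu
    simp only [hc, hxr u hu, hyr u hu, Real.cos_sub]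
    ring
  have hqu : ∀ u ∈ s, q u = r u * Real.sin (φ u - φ t) := by
    intro u hu
    simp only [hq, hxr u hu, hyr u hu, Real.sin_sub]
    ring
  have hct : c t = r t := by simp [hcu t ht]
  have hqt : q t = 0 := by simp [hqu t ht]
  have hrt := hr t ht
  have hdc : HasDerivWithinAt c (x' * Real.cos (φ t) + y' * Real.sin (φ t)) s t :=
    (hx.mul_const _).add (hy.mul_const _)
  have hdq : HasDerivWithinAt q (-(x' * Real.sin (φ t)) + y' * Real.cos (φ t)) s t :=
    (hx.mul_const _).neg.add (hy.mul_const _)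
  have hd := ((hdq.div hdc (by rw [hct]; exact hrt.ne')).arctan).const_add (φ t)
  -- Continuity keeps `φ u - φ t` within `π / 2`, which excludes jumps by multiples of `2π`.
  have hev : ∀ᶠ u in nhdsWithin t s, φ u = φ t + Real.arctan (q u / c u) := by
    have h1 : ∀ᶠ u in nhdsWithin t s, φ u ∈ Metric.ball (φ t) (Real.pi / 2) :=
      hφ (Metric.ball_mem_nhds _ (by positivity))
    filter_upwards [h1, self_mem_nhdsWithin] with u hu hus
    rw [Metric.mem_ball, Real.dist_eq, abs_lt] at hu
    rw [hcu u hus, hqu u hus, mul_div_mul_left _ _ (hr u hus).ne', ← Real.tan_eq_sin_div_cos,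
      Real.arctan_tan (by linarith [hu.1]) hu.2]
    ring
  have hd' := hd.congr_of_eventuallyEq hev (by simp [hqt])
  refine hd'.congr_deriv ?_
  rw [Pi.div_apply, hqt, hct]
  have h3 : x t ^ 2 + y t ^ 2 = r t ^ 2 := by
    rw [hxr t ht, hyr t ht]; linear_combination (r t)^2 * Real.sin_sq_add_cos_sq (φ t)
  rw [h3, hxr t ht, hyr t ht] at hω
  have : ω * r t = Real.cos (φ t) * y' - Real.sin (φ t) * x' := by
    apply mul_right_cancel₀ hrt.ne'; linear_combination -hω
  field_simp
  linear_combination -(r t) * this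

theorem _root_.HasDerivWithinAt.dotProduct_const {n : Type*} [Fintype n] {f : ℝ → n → ℝ} {f' : n → ℝ}
    {s : Set ℝ} {t : ℝ} (h : HasDerivWithinAt f f' s t) (w : n → ℝ) :
    HasDerivWithinAt (fun u => f u ⬝ᵥ w) (f' ⬝ᵥ w) s t := by
  unfold dotProduct
  exact HasDerivWithinAt.fun_sum fun i _ => (hasDerivWithinAt_pi.1 h i).mul_const (w i)

theorem mulVec_dotProduct_eq {R : Matrix (Fin 3) (Fin 3) ℝ} (v w : Fin 3 → ℝ) :
    (R *ᵥ v) ⬝ᵥ w = v ⬝ᵥ (Rᵀ *ᵥ w) := by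
  rw [Matrix.mulVec_transpose, dotProduct_comm, Matrix.dotProduct_mulVec, dotProduct_comm]

/-! ### Rotation matrices, dot and cross products -/

section SpecialOrthogonal

variable {R : Matrix (Fin 3) (Fin 3) ℝ}

theorem transpose_mulVec_mulVec (hR : R ∈ Matrix.specialOrthogonalGroup (Fin 3) ℝ)
    (v : Fin 3 → ℝ) : Rᵀ *ᵥ (R *ᵥ v) = v := by
  rw [Matrix.mulVec_mulVec,
    (Matrix.mem_orthogonalGroup_iff' _ _).1 (Matrix.mem_specialOrthogonalGroup_iff.1 hR).1,
    Matrix.one_mulVec]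

theorem mulVec_transpose_mulVec (hR : R ∈ Matrix.specialOrthogonalGroup (Fin 3) ℝ)
    (v : Fin 3 → ℝ) : R *ᵥ (Rᵀ *ᵥ v) = v := by
  rw [Matrix.mulVec_mulVec,
    (Matrix.mem_orthogonalGroup_iff _ _).1 (Matrix.mem_specialOrthogonalGroup_iff.1 hR).1,
    Matrix.one_mulVec]

theorem mulVec_dotProduct_mulVec (hR : R ∈ Matrix.specialOrthogonalGroup (Fin 3) ℝ)
    (v w : Fin 3 → ℝ) : (R *ᵥ v) ⬝ᵥ (R *ᵥ w) = v ⬝ᵥ w := by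
  rw [mulVec_dotProduct_eq, transpose_mulVec_mulVec hR]

/-- Tested against a vector `R c`, both sides are triple products, that is determinants, and these
agree because `det R = 1`. -/
theorem mulVec_crossProduct (hR : R ∈ Matrix.specialOrthogonalGroup (Fin 3) ℝ)
    (v w : Fin 3 → ℝ) : R *ᵥ (crossProduct v w) = crossProduct (R *ᵥ v) (R *ᵥ w) := by
  refine dotProduct_eq _ _ fun u => ?_
  rw [dotProduct_comm, dotProduct_comm _ u]
  have hu := mulVec_transpose_mulVec hR u
  generalize Rᵀ *ᵥ u = c at hu
  subst hu
  rw [mulVec_dotProduct_mulVec hR, triple_product_eq_det, triple_product_eq_det]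
  have : (![R *ᵥ c, R *ᵥ v, R *ᵥ w] : Matrix (Fin 3) (Fin 3) ℝ) = Matrix.of ![c, v, w] * Rᵀ := by
    ext i j
    fin_cases i <;> simp [Matrix.mul_apply, Matrix.mulVec, dotProduct, mul_comm]
  rw [this, Matrix.det_mul, Matrix.det_transpose, (Matrix.mem_specialOrthogonalGroup_iff.1 hR).2,
    mul_one]
  rfl

end SpecialOrthogonal

/-! ### Rigid motions: Euler equations and azimuth rates -/

/-- In a rigid motion the angular momentum in the body frame solves the Euler equations. -/
theorem IsRigidMotion.hasDerivWithinAt_angularMomentum {I : Matrix (Fin 3) (Fin 3) ℝ}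
    {ℓ : Fin 3 → ℝ} {a b : ℝ} {R : ℝ → Matrix (Fin 3) (Fin 3) ℝ} (h : IsRigidMotion I ℓ a b R)
    {t : ℝ} (ht : t ∈ Icc a b) :
    HasDerivWithinAt (fun s => (R s)ᵀ *ᵥ ℓ)
      (crossProduct ((R t)ᵀ *ᵥ ℓ) (I⁻¹ *ᵥ ((R t)ᵀ *ᵥ ℓ))) (Icc a b) t := by
  rw [hasDerivWithinAt_pi]
  intro i
  -- The components of `Rᵀ ℓ` are the products `(R e_i) ⬝ᵥ ℓ`, whose derivatives the kinematic
  -- equation gives.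
  have key : ∀ (w : Fin 3 → ℝ) s, w ⬝ᵥ ((R s)ᵀ *ᵥ ℓ) = (R s *ᵥ w) ⬝ᵥ ℓ := fun w s =>
    (mulVec_dotProduct_eq _ _).symm
  have h1 := ((h t ht).2 (Pi.single i 1)).dotProduct_const ℓ
  simp only [← key, single_one_dotProduct] at h1
  refine h1.congr_deriv ?_
  generalize (R t)ᵀ *ᵥ ℓ = L
  rw [dotProduct_comm, triple_product_permutation, triple_product_permutation,
    single_one_dotProduct]

/-- The azimuth rate about `ℓ` of a direction `v` fixed in a freely rotating body. -/
theorem IsRigidMotion.hasDerivWithinAt_azimuth {I : Matrix (Fin 3) (Fin 3) ℝ}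
    {ℓ : Fin 3 → ℝ} {a b l : ℝ} {R : ℝ → Matrix (Fin 3) (Fin 3) ℝ} (h : IsRigidMotion I ℓ a b R)
    (hl : 0 < l) (hℓ : ℓ ⬝ᵥ ℓ = l ^ 2) {ref v : Fin 3 → ℝ} (href : ref ⬝ᵥ ref = 1)
    (hperp : ref ⬝ᵥ ℓ = 0) {φ : ℝ → ℝ} (hφ : ContinuousOn φ (Icc a b))
    (haz : ∀ t ∈ Icc a b, IsAzimuth (l⁻¹ • ℓ) ref (R t *ᵥ v) (φ t)) {t ω : ℝ} (ht : t ∈ Icc a b)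
    (hω : l * (((R t)ᵀ *ᵥ ℓ) ⬝ᵥ
        (crossProduct v (crossProduct (I⁻¹ *ᵥ ((R t)ᵀ *ᵥ ℓ)) v))) =
      ω * (l ^ 2 * (v ⬝ᵥ v) - (v ⬝ᵥ ((R t)ᵀ *ᵥ ℓ)) ^ 2)) :
    HasDerivWithinAt φ ω (Icc a b) t := by
  choose! r hr0 hr1 hr2 using haz
  have hd := (h t ht).2 v
  refine hasDerivWithinAt_polar_angle ht (hφ t ht) (hd.dotProduct_const ref)
    (hd.dotProduct_const (crossProduct (l⁻¹ • ℓ) ref)) hr0 hr1 hr2 ?_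
  have hR := (h t ht).1
  set d := crossProduct (I⁻¹ *ᵥ ((R t)ᵀ *ᵥ ℓ)) v
  -- Passing from the body frame to space turns `hω` into a relation between `p = R v`, its velocity
  -- `q = R d`, and `ℓ`.
  have e1 : ((R t)ᵀ *ᵥ ℓ) ⬝ᵥ (crossProduct v d) =
      ℓ ⬝ᵥ (crossProduct (R t *ᵥ v) (R t *ᵥ d)) := by
    rw [← mulVec_crossProduct hR, dotProduct_comm, ← mulVec_dotProduct_eq, dotProduct_comm]
  have e2 : v ⬝ᵥ ((R t)ᵀ *ᵥ ℓ) = (R t *ᵥ v) ⬝ᵥ ℓ := (mulVec_dotProduct_eq _ _).symm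
  have e3 : v ⬝ᵥ v = (R t *ᵥ v) ⬝ᵥ (R t *ᵥ v) := (mulVec_dotProduct_mulVec hR v v).symm
  rw [e1, e2, e3] at hω
  generalize R t *ᵥ v = p at *
  generalize R t *ᵥ d = q at *
  clear e1 e2 e3 hd
  have cr : ∀ x y : Fin 3 → ℝ, crossProduct x y =
    ![x 1 * y 2 - x 2 * y 1, x 2 * y 0 - x 0 * y 2, x 0 * y 1 - x 1 * y 0] := cross_apply
  have dp : ∀ x y : Fin 3 → ℝ, x ⬝ᵥ y = x 0 * y 0 + x 1 * y 1 + x 2 * y 2 := fun x y => by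
    simp [dotProduct, Fin.sum_univ_three]
  -- `ref` and `l⁻¹ • ℓ × ref` are an orthonormal basis of the plane orthogonal to `ℓ`
  have f1 : l * ((p ⬝ᵥ ref) * (q ⬝ᵥ (crossProduct (l⁻¹ • ℓ) ref)) -
      (p ⬝ᵥ (crossProduct (l⁻¹ • ℓ) ref)) * (q ⬝ᵥ ref)) = ℓ ⬝ᵥ (crossProduct p q) := by
    rw [map_smul, LinearMap.smul_apply, dotProduct_smul, dotProduct_smul, smul_eq_mul, smul_eq_mul]
    have : (p ⬝ᵥ ref) * (q ⬝ᵥ (crossProduct ℓ ref)) - (p ⬝ᵥ (crossProduct ℓ ref)) * (q ⬝ᵥ ref)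
        = (ref ⬝ᵥ ref) * (ℓ ⬝ᵥ (crossProduct p q)) -
          (ref ⬝ᵥ ℓ) * (ref ⬝ᵥ (crossProduct p q)) := by
      simp only [cr, dp, Matrix.cons_val]
      ring
    rw [href, hperp] at this
    field_simp
    linarith
  have f2 : l ^ 2 * ((p ⬝ᵥ ref) ^ 2 + (p ⬝ᵥ (crossProduct (l⁻¹ • ℓ) ref)) ^ 2) =
      l ^ 2 * (p ⬝ᵥ p) - (p ⬝ᵥ ℓ) ^ 2 := by
    rw [map_smul, LinearMap.smul_apply, dotProduct_smul, smul_eq_mul]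
    have : (p ⬝ᵥ (crossProduct ℓ ref)) ^ 2 = (p ⬝ᵥ p) * ((ℓ ⬝ᵥ ℓ) * (ref ⬝ᵥ ref)
        - (ref ⬝ᵥ ℓ) ^ 2) - (p ⬝ᵥ ℓ) ^ 2 * (ref ⬝ᵥ ref) - (p ⬝ᵥ ref) ^ 2 * (ℓ ⬝ᵥ ℓ)
        + 2 * (p ⬝ᵥ ℓ) * (p ⬝ᵥ ref) * (ref ⬝ᵥ ℓ) := by
      simp only [cr, dp, Matrix.cons_val]
      ring
    rw [href, hperp, hℓ] at this
    field_simp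
    linarith
  have hl2 : l ^ 2 ≠ 0 := by positivity
  apply mul_left_cancel₀ hl2
  linear_combination l * f1 + hω - ω * f2

theorem contDiff_euler (I : Matrix (Fin 3) (Fin 3) ℝ) :
    ContDiff ℝ 1 fun L : Fin 3 → ℝ => crossProduct L (I⁻¹ *ᵥ L) := by
  simp only [cross_apply, Matrix.mulVec, dotProduct, Fin.sum_univ_three]
  rw [contDiff_pi]
  intro i
  fin_cases i <;> simp <;> fun_prop

/-- Along a rigid somersault about the `y`-axis, a principal axis, the body-frame angular momentum
stays constant. -/
theorem IsRigidMotion.angularMomentum_eq {I : Matrix (Fin 3) (Fin 3) ℝ}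
    {ℓ L₀ : Fin 3 → ℝ} {a b : ℝ} {R : ℝ → Matrix (Fin 3) (Fin 3) ℝ} (h : IsRigidMotion I ℓ a b R)
    (h₀ : (R a)ᵀ *ᵥ ℓ = L₀) (hL : crossProduct L₀ (I⁻¹ *ᵥ L₀) = 0) :
    ∀ t ∈ Icc a b, (R t)ᵀ *ᵥ ℓ = L₀ := by
  exact eqOn_of_autonomous_solutions (contDiff_euler I) (fun t ht => h.hasDerivWithinAt_angularMomentum ht)
    (g := fun _ => L₀) (fun t _ => by simpa only [hL] using hasDerivWithinAt_const t _ L₀) h₀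

/-! ### Inverse inertia tensors, rotations about the `x`-axis, kicks -/

theorem inv_mulVec_eq_of_posDef {I : Matrix (Fin 3) (Fin 3) ℝ} (hI : I.PosDef) {v w : Fin 3 → ℝ}
    (h : I *ᵥ v = w) : I⁻¹ *ᵥ w = v := by
  rw [← h, Matrix.mulVec_mulVec, Matrix.nonsing_inv_mul _
    ((Matrix.isUnit_iff_isUnit_det _).1 hI.isUnit), Matrix.one_mulVec]

/-- If the `x`-axis is a principal axis of `I`, then it is one of `I⁻¹`. -/
theorem inv_mulVec_x {I : Matrix (Fin 3) (Fin 3) ℝ} (hI : I.PosDef) (h1 : I 0 1 = 0)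
    (h2 : I 0 2 = 0) (x : ℝ) : I⁻¹ *ᵥ ![x, 0, 0] = ![(I 0 0)⁻¹ * x, 0, 0] := by
  apply inv_mulVec_eq_of_posDef hI
  have h3 : I 1 0 = 0 := by simpa [h1] using hI.1.apply 0 1
  have h4 : I 2 0 = 0 := by simpa [h2] using hI.1.apply 0 2
  have h0 : I 0 0 ≠ 0 := hI.diag_pos.ne'
  ext i
  fin_cases i <;> simp [Matrix.mulVec, dotProduct, Fin.sum_univ_three, h0, h3, h4]

theorem inv_apply_zero_zero {I : Matrix (Fin 3) (Fin 3) ℝ} (hI : I.PosDef) (h1 : I 0 1 = 0)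
    (h2 : I 0 2 = 0) : I⁻¹ 0 0 = (I 0 0)⁻¹ := by
  have := congrFun (inv_mulVec_x hI h1 h2 1) 0
  simpa [Matrix.mulVec, dotProduct, Fin.sum_univ_three] using this

theorem rotX_mul (a b : ℝ) : rotX a * rotX b = rotX (a + b) := by
  ext i j
  fin_cases i <;> fin_cases j <;>
    simp [rotX, Matrix.mul_apply, Fin.sum_univ_three, Real.cos_add, Real.sin_add] <;> ring

theorem rotX_zero : rotX 0 = 1 := by
  ext i j
  fin_cases i <;> fin_cases j <;> simp [rotX]

theorem rotX_transpose (a : ℝ) : (rotX a)ᵀ = rotX (-a) := by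
  ext i j
  fin_cases i <;> fin_cases j <;> simp [rotX]

theorem rotX_mul_rotX_neg (a : ℝ) : rotX a * rotX (-a) = 1 := by
  rw [rotX_mul, add_neg_cancel, rotX_zero]

theorem rotX_neg_mul_rotX (a : ℝ) : rotX (-a) * rotX a = 1 := by
  rw [rotX_mul, neg_add_cancel, rotX_zero]

/-- The derivative of a primitive of a function that is continuous on `[a, b]`. -/
theorem hasDerivWithinAt_integral_of_continuousOn {f : ℝ → ℝ} {a b t : ℝ}
    (hf : ContinuousOn f (Icc a b)) (ht : t ∈ Icc a b) :
    HasDerivWithinAt (fun u => ∫ x in a..u, f x) (f t) (Icc a b) t := by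
  have hab : a ≤ b := ht.1.trans ht.2
  have hc : Continuous fun x => f (projIcc a b hab x) :=
    hf.comp_continuous (continuous_subtype_val.comp continuous_projIcc) fun x => (projIcc a b hab x).2
  have he : ∀ x ∈ Icc a b, f x = f (projIcc a b hab x) := fun x hx => by rw [projIcc_of_mem hab hx]
  have h1 := (hc.integral_hasStrictDerivAt a t).hasDerivAt.hasDerivWithinAt (s := Icc a b)
  rw [← he t ht] at h1
  refine h1.congr_of_mem (fun u hu => ?_) ht
  refine intervalIntegral.integral_congr fun x hx => ?_
  rw [uIcc_of_le hu.1] at hx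
  exact he x ⟨hx.1, hx.2.trans hu.2⟩

/-- The effect of a kick on the orientation. -/
theorem ArmDiver.IsKick.eq_mul_rotX {D : ArmDiver} {K : ℝ → Matrix (Fin 3) (Fin 3) ℝ}
    (h : D.IsKick K) : K 0 = K Real.pi * rotX D.tilt := by
  set f : ℝ → ℝ := fun α => ((D.inertia α)⁻¹ 0 0) * D.shift α with hf
  have hfc : ContinuousOn f (Icc 0 Real.pi) := by
    refine ContinuousOn.mul (ContinuousOn.congr (f := fun α => (D.inertia α 0 0)⁻¹) ?_ ?_)
      D.shift_continuousOn
    · exact (D.inertia_continuousOn 0 0).inv₀ fun α hα => (D.inertia_posDef α hα).diag_pos.ne'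
    · exact fun α hα => inv_apply_zero_zero (D.inertia_posDef α hα) (D.inertia_xy α hα)
        (D.inertia_xz α hα)
  have hω : ∀ α ∈ Icc 0 Real.pi, -((D.inertia α)⁻¹ *ᵥ ![D.shift α, 0, 0]) = ![-f α, 0, 0] := by
    intro α hα
    rw [inv_mulVec_x (D.inertia_posDef α hα) (D.inertia_xy α hα) (D.inertia_xz α hα), hf]
    simp [inv_apply_zero_zero (D.inertia_posDef α hα) (D.inertia_xy α hα) (D.inertia_xz α hα)]
  -- The angular velocity is along `e_x`, so column 0 of `K` is constant while columns 1 and 2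
  -- rotate into each other at rate `f`.
  have hd : ∀ i j, ∀ α ∈ Icc 0 Real.pi, HasDerivWithinAt (fun β => K β i j)
      ((K α *ᵥ (crossProduct ![-f α, 0, 0] (Pi.single j 1))) i) (Icc 0 Real.pi) α := by
    intro i j α hα
    have := hasDerivWithinAt_pi.1 ((h α hα).2 (Pi.single j 1)) i
    rw [hω α hα] at this
    simpa using this
  have h0 : ∀ i, ∀ α ∈ Icc 0 Real.pi, HasDerivWithinAt (fun β => K β i 0) 0 (Icc 0 Real.pi) α := by
    intro i α hα
    simpa [cross_apply, Matrix.mulVec, dotProduct, Fin.sum_univ_three] using hd i 0 α hα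
  have h1 : ∀ i, ∀ α ∈ Icc 0 Real.pi,
      HasDerivWithinAt (fun β => K β i 1) (-(f α * K α i 2)) (Icc 0 Real.pi) α := by
    intro i α hα
    simpa [cross_apply, Matrix.mulVec, dotProduct, Fin.sum_univ_three, mul_comm] using hd i 1 α hα
  have h2 : ∀ i, ∀ α ∈ Icc 0 Real.pi,
      HasDerivWithinAt (fun β => K β i 2) (f α * K α i 1) (Icc 0 Real.pi) α := by
    intro i α hα
    simpa [cross_apply, Matrix.mulVec, dotProduct, Fin.sum_univ_three, mul_comm] using hd i 2 α hα
  set θ : ℝ → ℝ := fun u => ∫ x in (0 : ℝ)..u, f x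
  have hθ : ∀ α ∈ Icc 0 Real.pi, HasDerivWithinAt θ (f α) (Icc 0 Real.pi) α := fun α hα =>
    hasDerivWithinAt_integral_of_continuousOn hfc hα
  have hθ0 : θ 0 = 0 := intervalIntegral.integral_same
  have hpi : Real.pi ∈ Icc (0 : ℝ) Real.pi := ⟨Real.pi_pos.le, le_rfl⟩
  -- Undoing the rotation by `θ`, the primitive of `f`, makes columns 1 and 2 constant; comparing
  -- the values at `0` and `π` gives the claim.
  have g1 := fun i => eq_left_of_hasDerivWithinAt_zero (fun α hα =>
    (((h1 i α hα).fun_mul (hθ α hα).cos).fun_add ((h2 i α hα).fun_mul (hθ α hα).sin)).congr_deriv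
    (show _ = (0 : ℝ) by ring)) Real.pi hpi
  have g2 := fun i => eq_left_of_hasDerivWithinAt_zero (fun α hα =>
    (((h2 i α hα).fun_mul (hθ α hα).cos).fun_sub ((h1 i α hα).fun_mul (hθ α hα).sin)).congr_deriv
    (show _ = (0 : ℝ) by ring)) Real.pi hpi
  have g0 := fun i => eq_left_of_hasDerivWithinAt_zero (h0 i) Real.pi hpi
  have hθpi : θ Real.pi = D.tilt := rfl
  simp only [hθ0, hθpi, Real.cos_zero, Real.sin_zero, mul_one, mul_zero, add_zero, sub_zero]
    at g0 g1 g2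
  ext i j
  fin_cases j
  · simp [rotX, Matrix.mul_apply, Fin.sum_univ_three, g0]
  · simp [rotX, Matrix.mul_apply, Fin.sum_univ_three, ← g1]
  · simp [rotX, Matrix.mul_apply, Fin.sum_univ_three, ← g2]
    ring

/-! ### The somersault stages -/

namespace ArmDiver

variable (D : ArmDiver) (l : ℝ)

theorem zero_mem_Icc_pi : (0 : ℝ) ∈ Icc 0 Real.pi := ⟨le_rfl, Real.pi_pos.le⟩

theorem pi_mem_Icc_pi : Real.pi ∈ Icc (0 : ℝ) Real.pi := ⟨Real.pi_pos.le, le_rfl⟩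

theorem Is_inv_mulVec_Ls : D.Is⁻¹ *ᵥ D.Ls l = ![0, (D.Is 1 1)⁻¹ * l, 0] := by
  have hI : D.Is.PosDef := D.inertia_posDef _ pi_mem_Icc_pi
  apply inv_mulVec_eq_of_posDef hI
  have h1 : D.Is 0 1 = 0 := D.inertia_xy _ pi_mem_Icc_pi
  have h2 : D.Is 2 1 = 0 := (hI.1.apply 1 2).trans D.inertia_somersault_yz
  have h0 : D.Is 1 1 ≠ 0 := hI.diag_pos.ne'
  ext i
  fin_cases i <;> simp [Matrix.mulVec, dotProduct, Fin.sum_univ_three, h0, h1, h2, Ls]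

theorem Es_eq : D.Es l = (D.Is 1 1)⁻¹ * l ^ 2 / 2 := by
  rw [Es, energy, Is_inv_mulVec_Ls]
  simp [Ls, dotProduct, Fin.sum_univ_three]
  ring

/-- In the somersault stages the body-frame angular momentum is constant and the azimuth of `e_z`
about `ℓ` grows at the rate `2 E_s / l`. -/
theorem somersault_stage {l : ℝ} (hl : 0 < l) {ℓ : Fin 3 → ℝ} (hℓ : ℓ ⬝ᵥ ℓ = l ^ 2) {a b : ℝ}
    (hab : a ≤ b) {R : ℝ → Matrix (Fin 3) (Fin 3) ℝ} (h : IsRigidMotion D.Is ℓ a b R)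
    (h₀ : (R a)ᵀ *ᵥ ℓ = D.Ls l) :
    (R b)ᵀ *ᵥ ℓ = D.Ls l ∧
    ∀ (ref : Fin 3 → ℝ) (φ : ℝ → ℝ), ref ⬝ᵥ ref = 1 → ref ⬝ᵥ ℓ = 0 → ContinuousOn φ (Icc a b) →
      (∀ t ∈ Icc a b, IsAzimuth (l⁻¹ • ℓ) ref (R t *ᵥ ![0, 0, 1]) (φ t)) →
      φ b - φ a = 2 * D.Es l / l * (b - a) := by
  -- `Ls` and `Is⁻¹ Ls` are parallel, so `Ls` is an equilibrium.
  have hL := h.angularMomentum_eq h₀ (by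
    rw [Is_inv_mulVec_Ls]; simp [Ls, cross_apply])
  refine ⟨hL b ⟨hab, le_rfl⟩, fun ref φ href hperp hφ haz => ?_⟩
  refine sub_eq_of_hasDerivWithinAt_const (fun t ht => ?_) b ⟨hab, le_rfl⟩
  refine h.hasDerivWithinAt_azimuth hl hℓ href hperp hφ haz ht ?_
  rw [hL t ht, Is_inv_mulVec_Ls, Es_eq]
  simp [cross_apply, Ls, dotProduct, Fin.sum_univ_three]
  field_simp

end ArmDiver

theorem _root_.Function.Periodic.integral_zero_add_nat_mul {f : ℝ → ℝ} {T : ℝ} (hf : Continuous f)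
    (hp : Function.Periodic f T) (x : ℝ) (n : ℕ) :
    ∫ u in (0 : ℝ)..(x + n * T), f u = (∫ u in (0 : ℝ)..x, f u) + n * ∫ u in (0 : ℝ)..T, f u := by
  induction n with
  | zero => simp
  | succ n ih =>
    have h1 := hp.intervalIntegral_add_eq (x + n * T) 0
    have h2 := intervalIntegral.integral_add_adjacent_intervals
      (hf.intervalIntegrable (μ := volume) 0 (x + n * T))
      (hf.intervalIntegrable (x + n * T) (x + n * T + T))
    rw [show x + ((n + 1 : ℕ) : ℝ) * T = x + n * T + T by push_cast; ring, ← h2, h1, ih, zero_add]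
    push_cast
    ring

/-! ### The twisting orbit, parametrised by azimuth -/

section Orbit

/-- The form that the energy relation `a z² = b₁ x² + b₀ y²` takes in the direction `ψ`. -/
noncomputable def orbitForm (b₀ b₁ ψ : ℝ) : ℝ := b₀ * Real.cos ψ ^ 2 + b₁ * Real.sin ψ ^ 2

/-- The height over the equator of the curve `a z² = b₁ x² + b₀ y²` of the unit sphere, as a
function of the azimuth. -/
noncomputable def orbitHeight (a b₀ b₁ ψ : ℝ) : ℝ :=
  √(orbitForm b₀ b₁ ψ) / √(a + orbitForm b₀ b₁ ψ)

/-- The speed of the azimuth along the orbit of the Euler equations, on the unit sphere. -/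
noncomputable def orbitSpeed (a b₀ b₁ ψ : ℝ) : ℝ :=
  √(orbitForm b₀ b₁ ψ) * √(a + orbitForm b₀ b₁ ψ)

/-- The time that the orbit on the sphere of radius `l` needs to sweep the azimuths from `0`
to `x`. -/
noncomputable def orbitTime (a b₀ b₁ l x : ℝ) : ℝ :=
  ∫ ψ in (0 : ℝ)..x, (l * orbitSpeed a b₀ b₁ ψ)⁻¹

/-- The point of the orbit on the sphere of radius `l` with azimuth `-σ θ`. -/
noncomputable def orbitPoint (a b₀ b₁ l σ θ : ℝ) : Fin 3 → ℝ :=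
  ![l * √a * (σ * Real.sin θ) / √(a + orbitForm b₀ b₁ θ),
    l * √a * Real.cos θ / √(a + orbitForm b₀ b₁ θ), σ * l * orbitHeight a b₀ b₁ θ]

variable {a b₀ b₁ l σ : ℝ}

theorem orbitForm_pos (hb₀ : 0 < b₀) (hb₁ : 0 < b₁) (ψ : ℝ) : 0 < orbitForm b₀ b₁ ψ := by
  have h := Real.sin_sq_add_cos_sq ψ
  unfold orbitForm
  rcases le_total b₀ b₁ with hb | hb <;>
    nlinarith [sq_nonneg (Real.sin ψ), sq_nonneg (Real.cos ψ)]

@[fun_prop] theorem continuous_orbitForm : Continuous (orbitForm b₀ b₁) := by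
  unfold orbitForm; fun_prop

theorem orbitForm_periodic : Function.Periodic (orbitForm b₀ b₁) (2 * Real.pi) := fun x => by
  simp [orbitForm]

theorem orbitHeight_periodic : Function.Periodic (orbitHeight a b₀ b₁) (2 * Real.pi) := fun x => by
  simp [orbitHeight, orbitForm_periodic x]

theorem orbitSpeed_periodic : Function.Periodic (orbitSpeed a b₀ b₁) (2 * Real.pi) := fun x => by
  simp [orbitSpeed, orbitForm_periodic x]

theorem hasDerivAt_orbitForm (ψ : ℝ) :
    HasDerivAt (orbitForm b₀ b₁) (2 * (b₁ - b₀) * (Real.sin ψ * Real.cos ψ)) ψ := by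
  unfold orbitForm
  exact ((((Real.hasDerivAt_cos ψ).fun_pow 2).const_mul b₀).fun_add
    (((Real.hasDerivAt_sin ψ).fun_pow 2).const_mul b₁)).congr_deriv (by push_cast; ring)

section

variable (ha : 0 < a) (hb₀ : 0 < b₀) (hb₁ : 0 < b₁)
include ha hb₀ hb₁

theorem orbitSpeed_pos (ψ : ℝ) : 0 < orbitSpeed a b₀ b₁ ψ := by
  have := orbitForm_pos hb₀ hb₁ ψ
  unfold orbitSpeed
  positivity

theorem orbitHeight_pos (ψ : ℝ) : 0 < orbitHeight a b₀ b₁ ψ := by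
  have := orbitForm_pos hb₀ hb₁ ψ
  unfold orbitHeight
  positivity

theorem orbitHeight_sq (ψ : ℝ) :
    orbitHeight a b₀ b₁ ψ ^ 2 = orbitForm b₀ b₁ ψ / (a + orbitForm b₀ b₁ ψ) := by
  have := orbitForm_pos hb₀ hb₁ ψ
  rw [orbitHeight, div_pow, Real.sq_sqrt this.le, Real.sq_sqrt (by positivity)]

/-- This links the azimuth speed to the height; with `orbitHeight_sq` it gives height times speed
equal to `orbitForm`, the source of the geometric phase. -/
theorem orbitHeight_mul (ψ : ℝ) :
    orbitHeight a b₀ b₁ ψ * (a + orbitForm b₀ b₁ ψ) = orbitSpeed a b₀ b₁ ψ := by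
  have := orbitForm_pos hb₀ hb₁ ψ
  have h2 : 0 < √(a + orbitForm b₀ b₁ ψ) := by positivity
  have h3 := Real.sq_sqrt (show 0 ≤ a + orbitForm b₀ b₁ ψ by positivity)
  rw [orbitHeight, orbitSpeed]
  field_simp
  exact h3.symm

theorem continuous_orbitHeight : Continuous (orbitHeight a b₀ b₁) := by
  unfold orbitHeight
  refine Continuous.div (by fun_prop) (by fun_prop) fun ψ => ?_
  have := orbitForm_pos hb₀ hb₁ ψ
  positivity

variable (hl : 0 < l)
include hl

theorem continuous_orbitSpeed_inv : Continuous fun ψ => (l * orbitSpeed a b₀ b₁ ψ)⁻¹ := by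
  refine Continuous.inv₀ (by unfold orbitSpeed; fun_prop) fun ψ => ?_
  have := orbitSpeed_pos ha hb₀ hb₁ ψ
  positivity

theorem hasDerivAt_orbitTime (x : ℝ) :
    HasDerivAt (orbitTime a b₀ b₁ l) (l * orbitSpeed a b₀ b₁ x)⁻¹ x :=
  ((continuous_orbitSpeed_inv ha hb₀ hb₁ hl).integral_hasStrictDerivAt 0 x).hasDerivAt

theorem strictMono_orbitTime : StrictMono (orbitTime a b₀ b₁ l) := by
  refine strictMono_of_deriv_pos fun x => ?_
  rw [(hasDerivAt_orbitTime ha hb₀ hb₁ hl x).deriv]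
  have := orbitSpeed_pos ha hb₀ hb₁ x
  positivity

theorem orbitTime_add (x : ℝ) (n : ℕ) : orbitTime a b₀ b₁ l (x + n * (2 * Real.pi)) =
    orbitTime a b₀ b₁ l x + n * orbitTime a b₀ b₁ l (2 * Real.pi) :=
  Function.Periodic.integral_zero_add_nat_mul (continuous_orbitSpeed_inv ha hb₀ hb₁ hl)
    (fun x => by simp [orbitSpeed_periodic x]) x n

omit ha hb₀ hb₁ hl in
theorem orbitTime_zero : orbitTime a b₀ b₁ l 0 = 0 := intervalIntegral.integral_same

theorem orbitTime_two_pi_pos : 0 < orbitTime a b₀ b₁ l (2 * Real.pi) := by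
  have := strictMono_orbitTime ha hb₀ hb₁ hl Real.two_pi_pos
  rwa [orbitTime_zero] at this

/-- Each turn adds the same positive time, so `orbitTime` is unbounded in both directions, and it is
continuous. -/
theorem surjective_orbitTime : Function.Surjective (orbitTime a b₀ b₁ l) := by
  intro y
  have hT := orbitTime_two_pi_pos ha hb₀ hb₁ hl
  obtain ⟨n, hn⟩ := exists_nat_ge (|y| / orbitTime a b₀ b₁ l (2 * Real.pi))
  rw [div_le_iff₀ hT] at hn
  have h1 := orbitTime_add ha hb₀ hb₁ hl 0 n
  have h2 := orbitTime_add ha hb₀ hb₁ hl (-(n * (2 * Real.pi))) n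
  rw [neg_add_cancel, orbitTime_zero] at h2
  rw [orbitTime_zero] at h1
  refine mem_range_of_exists_le_of_exists_ge
    (continuous_iff_continuousAt.2 fun x => (hasDerivAt_orbitTime ha hb₀ hb₁ hl x).continuousAt)
    ⟨-(n * (2 * Real.pi)), ?_⟩ ⟨0 + n * (2 * Real.pi), ?_⟩
  · linarith [neg_abs_le y]
  · linarith [le_abs_self y]

/-- The azimuth along the orbit, as a function of time. -/
theorem exists_orbitAngle : ∃ θ : ℝ → ℝ, (∀ t, orbitTime a b₀ b₁ l (θ t) = t) ∧
    ∀ t, HasDerivAt θ (l * orbitSpeed a b₀ b₁ (θ t)) t := by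
  -- The azimuth is the inverse function of elapsed time, so its derivative is the reciprocal of the
  -- integrand.
  let e := StrictMono.orderIsoOfSurjective _ (strictMono_orbitTime ha hb₀ hb₁ hl)
    (surjective_orbitTime ha hb₀ hb₁ hl)
  have he : ∀ t, orbitTime a b₀ b₁ l (e.symm t) = t := fun t => e.apply_symm_apply t
  refine ⟨e.symm, he, fun t => ?_⟩
  have := orbitSpeed_pos ha hb₀ hb₁ (e.symm t)
  have h := HasDerivAt.of_local_left_inverse e.symm.continuous.continuousAt
    (hasDerivAt_orbitTime ha hb₀ hb₁ hl (e.symm t)) (by positivity) (.of_forall he)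
  rwa [inv_inv] at h

omit hl in
/-- The orbit solves the Euler equations in the frame of the principal axes. -/
theorem hasDerivAt_orbitPoint {k : Fin 3 → ℝ} (hσ : σ ^ 2 = 1) (hk0 : k 0 = k 2 - (a + b₁))
    (hk1 : k 1 = k 2 - (a + b₀)) {θ : ℝ → ℝ} {t : ℝ}
    (hθ : HasDerivAt θ (l * orbitSpeed a b₀ b₁ (θ t)) t) :
    HasDerivAt (fun u => orbitPoint a b₀ b₁ l σ (θ u))
      (crossProduct (orbitPoint a b₀ b₁ l σ (θ t)) (k * orbitPoint a b₀ b₁ l σ (θ t))) t := by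
  have hb := orbitForm_pos hb₀ hb₁ (θ t)
  have hf : HasDerivAt (fun u => orbitForm b₀ b₁ (θ u)) _ t := (hasDerivAt_orbitForm (θ t)).comp t hθ
  have hd1 := hf.sqrt hb.ne'
  have hd2 := (hf.const_add a).sqrt (by positivity)
  have hγ : 0 < √(a + orbitForm b₀ b₁ (θ t)) := by positivity
  have hβ : 0 < √(orbitForm b₀ b₁ (θ t)) := by positivity
  have hα : 0 < √a := by positivity
  have eγ := Real.sq_sqrt (show 0 ≤ a + orbitForm b₀ b₁ (θ t) by positivity)
  have eβ := Real.sq_sqrt hb.le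
  have eα := Real.sq_sqrt ha.le
  have hsc := Real.sin_sq_add_cos_sq (θ t)
  rw [hasDerivAt_pi]
  have hform : orbitForm b₀ b₁ (θ t) = b₀ * Real.cos (θ t) ^ 2 + b₁ * Real.sin (θ t) ^ 2 := rfl
  intro i
  fin_cases i
  · refine (((hθ.sin.const_mul σ).const_mul (l * √a)).fun_div hd2 hγ.ne').congr_deriv ?_
    simp [cross_apply, orbitPoint, orbitHeight, orbitSpeed, hk0, hk1]
    -- The roots, sine and cosine become free variables tied only by `eα`, `eβ`, `eγ`, `hform`,
    -- `hsc`; what remains is polynomial algebra.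
    generalize √(a + orbitForm b₀ b₁ (θ t)) = γ at *
    generalize √(orbitForm b₀ b₁ (θ t)) = β at *
    generalize √a = α at *
    generalize orbitForm b₀ b₁ (θ t) = b at *
    generalize Real.sin (θ t) = s at *
    generalize Real.cos (θ t) = c at *
    field_simp
    linear_combination l ^ 2 * σ * c * (eγ + hform + b₀ * hsc)
  · refine ((hθ.cos.const_mul (l * √a)).fun_div hd2 hγ.ne').congr_deriv ?_
    simp [cross_apply, orbitPoint, orbitHeight, orbitSpeed, hk0, hk1]
    generalize √(a + orbitForm b₀ b₁ (θ t)) = γ at *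
    generalize √(orbitForm b₀ b₁ (θ t)) = β at *
    generalize √a = α at *
    generalize orbitForm b₀ b₁ (θ t) = b at *
    generalize Real.sin (θ t) = s at *
    generalize Real.cos (θ t) = c at *
    field_simp
    linear_combination l ^ 2 * s * (-eγ - hform - b₁ * hsc + (a + b₁) * hσ)
  · refine ((hd1.fun_div hd2 hγ.ne').const_mul (σ * l)).congr_deriv ?_
    simp [cross_apply, orbitPoint, orbitHeight, orbitSpeed, hk0, hk1]
    generalize √(a + orbitForm b₀ b₁ (θ t)) = γ at *
    generalize √(orbitForm b₀ b₁ (θ t)) = β at *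
    generalize √a = α at *
    generalize orbitForm b₀ b₁ (θ t) = b at *
    generalize Real.sin (θ t) = s at *
    generalize Real.cos (θ t) = c at *
    field_simp
    linear_combination σ * l ^ 2 * (b₁ - b₀) * s * c * (eγ - eβ - eα)

end

end Orbit

/-! ### Principal axes and the least period -/

theorem rotX_mem (P : ℝ) : rotX P ∈ Matrix.specialOrthogonalGroup (Fin 3) ℝ := by
  rw [Matrix.mem_specialOrthogonalGroup_iff]
  refine ⟨(Matrix.mem_orthogonalGroup_iff _ _).2 ?_, ?_⟩
  · rw [rotX_transpose, rotX_mul_rotX_neg]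
  · rw [rotX, Matrix.det_fin_three]
    simp
    linear_combination Real.sin_sq_add_cos_sq P

theorem rotX_mulVec_rotX_neg (P : ℝ) (v : Fin 3 → ℝ) : rotX P *ᵥ (rotX (-P) *ᵥ v) = v := by
  rw [Matrix.mulVec_mulVec, rotX_mul_rotX_neg, Matrix.one_mulVec]

theorem rotX_neg_mulVec_rotX (P : ℝ) (v : Fin 3 → ℝ) : rotX (-P) *ᵥ (rotX P *ᵥ v) = v := by
  rw [Matrix.mulVec_mulVec, rotX_neg_mul_rotX, Matrix.one_mulVec]

theorem _root_.HasDerivWithinAt.mulVec {f : ℝ → Fin 3 → ℝ} {f' : Fin 3 → ℝ} {s : Set ℝ} {t : ℝ}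
    (h : HasDerivWithinAt f f' s t) (A : Matrix (Fin 3) (Fin 3) ℝ) :
    HasDerivWithinAt (fun u => A *ᵥ f u) (A *ᵥ f') s t := by
  rw [hasDerivWithinAt_pi]
  intro i
  simp only [Matrix.mulVec, dotProduct_comm (fun j => A i j)]
  exact h.dotProduct_const _

/-- `I` is a tensor of inertia whose principal axes are those of the frame `rotX P`; the reciprocals
of the principal moments of inertia are `k`. -/
def HasPrincipalInv (I : Matrix (Fin 3) (Fin 3) ℝ) (P : ℝ) (k : Fin 3 → ℝ) : Prop :=
  ∀ L : Fin 3 → ℝ, I⁻¹ *ᵥ L = rotX P *ᵥ (k * (rotX (-P) *ᵥ L))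

section Principal

variable {I : Matrix (Fin 3) (Fin 3) ℝ} {P : ℝ} {J : Fin 3 → ℝ}

/-- `diagonal J` is congruent to the positive definite `I`. -/
theorem principal_moments_pos (hI : I.PosDef) (h : I = rotX P * Matrix.diagonal J * rotX (-P))
    (i : Fin 3) : 0 < J i := by
  have h1 : (rotX P).conjTranspose * I * rotX P = Matrix.diagonal J := by
    rw [Matrix.conjTranspose_eq_transpose_of_trivial, rotX_transpose, h]
    calc _ = (rotX (-P) * rotX P) * Matrix.diagonal J * (rotX (-P) * rotX P) := by
          simp only [Matrix.mul_assoc]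
      _ = _ := by rw [rotX_neg_mul_rotX, one_mul, mul_one]
  have h2 := hI.conjTranspose_mul_mul_same (B := rotX P)
    (Function.LeftInverse.injective (g := fun v => rotX (-P) *ᵥ v) (rotX_neg_mulVec_rotX P))
  rw [h1] at h2
  exact Matrix.posDef_diagonal_iff.1 h2 i

theorem hasPrincipalInv (hI : I.PosDef) (h : I = rotX P * Matrix.diagonal J * rotX (-P)) :
    HasPrincipalInv I P J⁻¹ := by
  intro L
  apply inv_mulVec_eq_of_posDef hI
  have hJ := principal_moments_pos hI h
  rw [h, ← Matrix.mulVec_mulVec, rotX_neg_mulVec_rotX, ← Matrix.mulVec_mulVec]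
  have : Matrix.diagonal J *ᵥ (J⁻¹ * (rotX (-P) *ᵥ L)) = rotX (-P) *ᵥ L := by
    ext i
    rw [Matrix.mulVec_diagonal]
    simp [(hJ i).ne']
  rw [this, rotX_mulVec_rotX_neg]

variable {k : Fin 3 → ℝ}

theorem HasPrincipalInv.energy_eq (h : HasPrincipalInv I P k) (L : Fin 3 → ℝ) :
    energy I L = (1 / 2) * ((rotX (-P) *ᵥ L) ⬝ᵥ (k * (rotX (-P) *ᵥ L))) := by
  rw [energy, h L, dotProduct_comm, mulVec_dotProduct_eq, rotX_transpose, dotProduct_comm]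

theorem HasPrincipalInv.rotX_neg_mulVec_euler (h : HasPrincipalInv I P k) (L : Fin 3 → ℝ) :
    rotX (-P) *ᵥ (crossProduct L (I⁻¹ *ᵥ L)) =
      crossProduct (rotX (-P) *ᵥ L) (k * (rotX (-P) *ᵥ L)) := by
  rw [mulVec_crossProduct (rotX_mem _), h L, rotX_neg_mulVec_rotX]

theorem HasPrincipalInv.rotX_mulVec_euler (h : HasPrincipalInv I P k) (M : Fin 3 → ℝ) :
    rotX P *ᵥ (crossProduct M (k * M)) =
      crossProduct (rotX P *ᵥ M) (I⁻¹ *ᵥ (rotX P *ᵥ M)) := by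
  rw [mulVec_crossProduct (rotX_mem _), h, rotX_neg_mulVec_rotX]

variable {a b₀ b₁ l σ : ℝ} (ha : 0 < a) (hb₀ : 0 < b₀) (hb₁ : 0 < b₁) (hl : 0 < l)
  (hσ : σ ^ 2 = 1) (hk0 : k 0 = k 2 - (a + b₁)) (hk1 : k 1 = k 2 - (a + b₀))
  (h : HasPrincipalInv I P k)
include ha hb₀ hb₁ hl hσ hk0 hk1 h

/-- The least period of the orbit that encircles the principal axis with the smallest moment of
inertia. -/
theorem eulerPeriod_eq_orbitTime {L₀ : Fin 3 → ℝ}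
    (h₀ : rotX (-P) *ᵥ L₀ = orbitPoint a b₀ b₁ l σ 0) :
    eulerPeriod I L₀ = orbitTime a b₀ b₁ l (2 * Real.pi) := by
  have hmono := strictMono_orbitTime ha hb₀ hb₁ hl
  obtain ⟨θ, hθ, hθ'⟩ := exists_orbitAngle ha hb₀ hb₁ hl
  have hθ0 : θ 0 = 0 := hmono.injective (by rw [hθ, orbitTime_zero])
  set Λ : ℝ → Fin 3 → ℝ := fun t => rotX P *ᵥ orbitPoint a b₀ b₁ l σ (θ t) with hΛdef
  have hΛ : IsEulerSolution I Λ := fun t => by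
    have := (hasDerivAt_orbitPoint ha hb₀ hb₁ hσ hk0 hk1 (hθ' t)).hasDerivWithinAt (s := univ)
    have := this.mulVec (rotX P)
    rw [h.rotX_mulVec_euler, hasDerivWithinAt_univ] at this
    exact this
  have hΛ0 : Λ 0 = L₀ := by
    simp only [hΛdef, hθ0, ← h₀, rotX_mulVec_rotX_neg]
  refine IsLeast.csInf_eq ⟨⟨orbitTime_two_pi_pos ha hb₀ hb₁ hl, Λ, hΛ, hΛ0, fun t => ?_⟩, ?_⟩
  · have : θ (t + orbitTime a b₀ b₁ l (2 * Real.pi)) = θ t + 2 * Real.pi := by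
      apply hmono.injective
      have := orbitTime_add ha hb₀ hb₁ hl (θ t) 1
      simp only [Nat.cast_one, one_mul] at this
      rw [hθ, this, hθ]
    simp only [hΛdef, this, orbitPoint, orbitForm_periodic (θ t), orbitHeight_periodic (θ t),
      Real.sin_add_two_pi, Real.cos_add_two_pi]
  · rintro T ⟨hT, Λ', hΛ', hΛ'0, hper⟩
    -- By uniqueness a competing periodic solution is the explicit one on `[0, T]`, so `orbitPoint`
    -- at `θ T` is back at its start.
    have hu := eqOn_of_autonomous_solutions (contDiff_euler I) (a := 0) (b := T)
      (fun t _ => (hΛ t).hasDerivWithinAt) (fun t _ => (hΛ' t).hasDerivWithinAt)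
      (hΛ0.trans hΛ'0.symm) (right_mem_Icc.2 hT.le)
    have hT0 : Λ' T = Λ 0 := by
      have := hper 0
      rw [zero_add] at this
      rw [this, hΛ'0, hΛ0]
    have hM : orbitPoint a b₀ b₁ l σ (θ T) = orbitPoint a b₀ b₁ l σ 0 := by
      rw [hT0] at hu
      have := congrArg (fun v => rotX (-P) *ᵥ v) hu
      simpa only [hΛdef, rotX_neg_mulVec_rotX, hθ0] using this
    have hb := orbitForm_pos hb₀ hb₁ (θ T)
    have hb' := orbitForm_pos hb₀ hb₁ 0
    have h1 := congrFun hM 0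
    have h2 := congrFun hM 1
    have hσ0 : σ ≠ 0 := by rintro rfl; simp at hσ
    have hg : √(a + orbitForm b₀ b₁ (θ T)) ≠ 0 := by positivity
    have hα : √a ≠ 0 := by positivity
    -- The `x`-coordinate forces `sin (θ T) = 0` and the positive `y`-coordinate selects `cos (θ T)
    -- = 1`, so `θ T` is a positive multiple of `2π`.
    have hsin : Real.sin (θ T) = 0 := by
      simpa [orbitPoint, hσ0, hg, hl.ne', hα] using h1
    have hcos : 0 < Real.cos (θ T) := by
      have : 0 < orbitPoint a b₀ b₁ l σ (θ T) 1 := by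
        rw [h2]
        simp only [orbitPoint, Matrix.cons_val, Real.cos_zero]
        positivity
      simp only [orbitPoint, Matrix.cons_val] at this
      by_contra hc
      refine absurd this (not_lt.2 (div_nonpos_of_nonpos_of_nonneg ?_ (by positivity)))
      exact mul_nonpos_of_nonneg_of_nonpos (by positivity) (not_lt.1 hc)
    have hcos1 : Real.cos (θ T) = 1 := by
      have := Real.sin_sq_add_cos_sq (θ T)
      rw [hsin] at this
      nlinarith
    obtain ⟨j, hj⟩ := (Real.cos_eq_one_iff _).1 hcos1
    have hθT : 0 < θ T := by
      rw [← hmono.lt_iff_lt, hθ, orbitTime_zero]; exact hT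
    have hj1 : (1 : ℝ) ≤ j := by
      rw [← hj] at hθT
      have : (0 : ℝ) < j := pos_of_mul_pos_left hθT Real.two_pi_pos.le
      exact_mod_cast this
    rw [← hθ T]
    refine hmono.monotone ?_
    rw [← hj]
    nlinarith [Real.two_pi_pos]

end Principal

/-! ### The twisting stage: elapsed time, return, and phase -/

section TwistStage

variable {I : Matrix (Fin 3) (Fin 3) ℝ} {P : ℝ} {k : Fin 3 → ℝ} {a b₀ b₁ l σ : ℝ}

/-- The polar form of a point of the orbit. -/
theorem orbit_polar (ha : 0 < a) (hb₀ : 0 < b₀) (hb₁ : 0 < b₁) {x y z r ψ : ℝ}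
    (hx : x = -(r * Real.sin ψ)) (hy : y = r * Real.cos ψ)
    (hnorm : x ^ 2 + y ^ 2 + z ^ 2 = l ^ 2) (hen : a * z ^ 2 = b₁ * x ^ 2 + b₀ * y ^ 2) :
    r ^ 2 = l ^ 2 * a / (a + orbitForm b₀ b₁ ψ) ∧ z ^ 2 = (l * orbitHeight a b₀ b₁ ψ) ^ 2 := by
  have hb := orbitForm_pos hb₀ hb₁ ψ
  have hsc := Real.sin_sq_add_cos_sq ψ
  have h1 : r ^ 2 + z ^ 2 = l ^ 2 := by
    rw [hx, hy] at hnorm; linear_combination hnorm - r ^ 2 * hsc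
  have h2 : a * z ^ 2 = r ^ 2 * orbitForm b₀ b₁ ψ := by
    rw [hen, hx, hy, orbitForm]; ring
  rw [mul_pow, orbitHeight_sq ha hb₀ hb₁]
  generalize orbitForm b₀ b₁ ψ = b at *
  constructor
  · field_simp
    linear_combination a * h1 - h2
  · field_simp
    linear_combination b * h1 + h2

/-- `M × (k * M)` is orthogonal both to `M` and to `k * M`, so norm and energy are conserved. -/
theorem conserved_of_euler {M : ℝ → Fin 3 → ℝ} {α β : ℝ}
    (hM : ∀ t ∈ Icc α β, HasDerivWithinAt M (crossProduct (M t) (k * M t)) (Icc α β) t)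
    {t : ℝ} (ht : t ∈ Icc α β) :
    M t 0 ^ 2 + M t 1 ^ 2 + M t 2 ^ 2 = M α 0 ^ 2 + M α 1 ^ 2 + M α 2 ^ 2 ∧
    k 0 * M t 0 ^ 2 + k 1 * M t 1 ^ 2 + k 2 * M t 2 ^ 2 =
      k 0 * M α 0 ^ 2 + k 1 * M α 1 ^ 2 + k 2 * M α 2 ^ 2 := by
  have hi : ∀ i, ∀ t ∈ Icc α β, HasDerivWithinAt (fun u => M u i ^ 2)
      (2 * M t i * crossProduct (M t) (k * M t) i) (Icc α β) t := fun i t ht =>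
    ((hasDerivWithinAt_pi.1 (hM t ht) i).fun_pow 2).congr_deriv (by push_cast; ring)
  constructor
  · exact eq_left_of_hasDerivWithinAt_zero (f := fun t => M t 0 ^ 2 + M t 1 ^ 2 + M t 2 ^ 2)
      (fun t ht => (((hi 0 t ht).fun_add (hi 1 t ht)).fun_add (hi 2 t ht)).congr_deriv (by
        simp [cross_apply]; ring)) t ht
  · exact eq_left_of_hasDerivWithinAt_zero
      (f := fun t => k 0 * M t 0 ^ 2 + k 1 * M t 1 ^ 2 + k 2 * M t 2 ^ 2)
      (fun t ht => ((((hi 0 t ht).const_mul (k 0)).fun_add ((hi 1 t ht).const_mul (k 1))).fun_add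
        ((hi 2 t ht).const_mul (k 2))).congr_deriv (by simp [cross_apply]; ring)) t ht

variable (ha : 0 < a) (hb₀ : 0 < b₀) (hb₁ : 0 < b₁) (hl : 0 < l)
  (hσ : σ ^ 2 = 1) (hk0 : k 0 = k 2 - (a + b₁)) (hk1 : k 1 = k 2 - (a + b₀))
  (h : HasPrincipalInv I P k)
include ha hb₀ hb₁ hl

omit hl in
theorem orbitPoint_zero_conserved :
    let x := orbitPoint a b₀ b₁ l σ 0 0
    let y := orbitPoint a b₀ b₁ l σ 0 1
    let z := orbitPoint a b₀ b₁ l σ 0 2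
    σ ^ 2 = 1 → x ^ 2 + y ^ 2 + z ^ 2 = l ^ 2 ∧ a * z ^ 2 = b₁ * x ^ 2 + b₀ * y ^ 2 := by
  intro x y z hσ
  have hb := orbitForm_pos hb₀ hb₁ 0
  have hf : orbitForm b₀ b₁ 0 = b₀ := by simp [orbitForm]
  simp only [x, y, z, orbitPoint, Matrix.cons_val, Real.sin_zero, Real.cos_zero, mul_pow, div_pow,
    orbitHeight_sq ha hb₀ hb₁, hf, Real.sq_sqrt ha.le, Real.sq_sqrt (add_pos ha hb₀).le, hσ]
  constructor
  · field_simp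
    ring
  · field_simp
    ring

include hσ hk0 hk1 h

/-- The twisting stage: after `n` revolutions of the angular momentum about the twist axis `n`
periods have passed, the angular momentum has come back, and the twist axis has turned by the
dynamic phase minus `n` times the solid angle. -/
theorem twist_stage {ℓ : Fin 3 → ℝ} (hℓ : ℓ ⬝ᵥ ℓ = l ^ 2) {α β : ℝ}
    (hαβ : α ≤ β) {R : ℝ → Matrix (Fin 3) (Fin 3) ℝ} (hR : IsRigidMotion I ℓ α β R)
    (h₀ : rotX (-P) *ᵥ ((R α)ᵀ *ᵥ ℓ) = orbitPoint a b₀ b₁ l σ 0) {ψ : ℝ → ℝ}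
    (hψ : ContinuousOn ψ (Icc α β))
    (hψaz : ∀ t ∈ Icc α β,
      IsAzimuth (rotX P *ᵥ ![0, 0, 1]) (rotX P *ᵥ ![0, 1, 0]) ((R t)ᵀ *ᵥ ℓ) (ψ t))
    {n : ℕ} (hn : |ψ β - ψ α| = 2 * Real.pi * n) :
    β - α = n * orbitTime a b₀ b₁ l (2 * Real.pi) ∧ (R β)ᵀ *ᵥ ℓ = (R α)ᵀ *ᵥ ℓ ∧
    ∀ (ref : Fin 3 → ℝ) (φ : ℝ → ℝ), ref ⬝ᵥ ref = 1 → ref ⬝ᵥ ℓ = 0 → ContinuousOn φ (Icc α β) →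
      (∀ t ∈ Icc α β, IsAzimuth (l⁻¹ • ℓ) ref (R t *ᵥ (rotX P *ᵥ ![0, 0, 1])) (φ t)) →
      φ β - φ α = l * (k 2 - a) * (β - α) -
        n * ∫ x in (0 : ℝ)..(2 * Real.pi), orbitHeight a b₀ b₁ x := by
  set M : ℝ → Fin 3 → ℝ := fun t => rotX (-P) *ᵥ ((R t)ᵀ *ᵥ ℓ) with hMdef
  have hM : ∀ t ∈ Icc α β, HasDerivWithinAt M (crossProduct (M t) (k * M t)) (Icc α β) t := by
    intro t ht
    have := (hR.hasDerivWithinAt_angularMomentum ht).mulVec (rotX (-P))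
    rwa [h.rotX_neg_mulVec_euler] at this
  have hαm : α ∈ Icc α β := left_mem_Icc.2 hαβ
  have hβm : β ∈ Icc α β := right_mem_Icc.2 hαβ
  obtain ⟨hn0, he0⟩ := orbitPoint_zero_conserved ha hb₀ hb₁ (l := l) hσ
  have hMα : M α = orbitPoint a b₀ b₁ l σ 0 := h₀
  rw [← hMα] at hn0 he0
  have hnorm : ∀ t ∈ Icc α β, M t 0 ^ 2 + M t 1 ^ 2 + M t 2 ^ 2 = l ^ 2 := fun t ht =>
    (conserved_of_euler hM ht).1.trans hn0
  have hen : ∀ t ∈ Icc α β, a * M t 2 ^ 2 = b₁ * M t 0 ^ 2 + b₀ * M t 1 ^ 2 := by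
    intro t ht
    have h1 := (conserved_of_euler hM ht).1
    have h2 := (conserved_of_euler hM ht).2
    rw [hk0, hk1] at h2
    linear_combination h2 - (k 2 - a) * h1 + he0
  choose! r hr0 hr1 hr2 using hψaz
  have hy : ∀ t ∈ Icc α β, M t 1 = r t * Real.cos (ψ t) := by
    intro t ht
    rw [← hr1 t ht, dotProduct_comm, mulVec_dotProduct_eq, rotX_transpose]
    simp [M, dotProduct, Fin.sum_univ_three]
  have hx' : ∀ t ∈ Icc α β, -M t 0 = r t * Real.sin (ψ t) := by
    intro t ht
    rw [← hr2 t ht, ← mulVec_crossProduct (rotX_mem P), dotProduct_comm, mulVec_dotProduct_eq,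
      rotX_transpose]
    simp [M, dotProduct, Fin.sum_univ_three, cross_apply]
  have hx : ∀ t ∈ Icc α β, M t 0 = -(r t * Real.sin (ψ t)) := fun t ht => by
    linarith [hx' t ht]
  have hpol := fun t ht => orbit_polar ha hb₀ hb₁ (hx t ht) (hy t ht) (hnorm t ht) (hen t ht)
  have hMi : ∀ i, ∀ t ∈ Icc α β, HasDerivWithinAt (fun u => M u i)
      (crossProduct (M t) (k * M t) i) (Icc α β) t := fun i t ht =>
    hasDerivWithinAt_pi.1 (hM t ht) i
  have hhc := continuous_orbitHeight ha hb₀ hb₁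
  -- the side of the equator does not change
  have hz : ∀ t ∈ Icc α β, M t 2 = σ * l * orbitHeight a b₀ b₁ (ψ t) := by
    have hcont : ContinuousOn (fun t => M t 2) (Icc α β) := fun t ht =>
      (hMi 2 t ht).continuousWithinAt
    have hcont2 : ContinuousOn (fun t => σ * l * orbitHeight a b₀ b₁ (ψ t)) (Icc α β) :=
      -- The squares of the two functions agree and the second never vanishes, so on the connected
      -- interval they agree up to one global sign, which the value at `α` decides.
      continuousOn_const.mul (hhc.comp_continuousOn hψ)
    have hσ0 : σ ≠ 0 := by rintro rfl; simp at hσ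
    have hne : ∀ t, σ * l * orbitHeight a b₀ b₁ (ψ t) ≠ 0 := fun t =>
      mul_ne_zero (mul_ne_zero hσ0 hl.ne') (orbitHeight_pos ha hb₀ hb₁ _).ne'
    rcases isPreconnected_Icc.eq_or_eq_neg_of_sq_eq hcont hcont2
      (fun t ht => by
        simp only [Pi.pow_apply, (hpol t ht).2]
        linear_combination -(l * orbitHeight a b₀ b₁ (ψ t)) ^ 2 * hσ)
      (fun {t} _ => hne t) with hc | hc
    · exact hc
    · exfalso
      have h1 := hc hαm
      simp only [Pi.neg_apply, hMα] at h1
      have h2 : orbitPoint a b₀ b₁ l σ 0 2 = σ * l * orbitHeight a b₀ b₁ 0 := rfl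
      have h3 : σ * l * (orbitHeight a b₀ b₁ 0 + orbitHeight a b₀ b₁ (ψ α)) = 0 := by
        rw [h2] at h1; linear_combination h1
      have := orbitHeight_pos ha hb₀ hb₁ 0
      have := orbitHeight_pos ha hb₀ hb₁ (ψ α)
      have h4 : orbitHeight a b₀ b₁ 0 + orbitHeight a b₀ b₁ (ψ α) ≠ 0 := by positivity
      exact mul_ne_zero (mul_ne_zero hσ0 hl.ne') h4 h3
  have hdψ : ∀ t ∈ Icc α β, HasDerivWithinAt ψ (-(σ * (l * orbitSpeed a b₀ b₁ (ψ t))))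
      (Icc α β) t := by
    intro t ht
    refine hasDerivWithinAt_polar_angle ht (hψ t ht) (hMi 1 t ht) (hMi 0 t ht).fun_neg hr0 hy hx' ?_
    rw [← orbitHeight_mul ha hb₀ hb₁]
    have h2 := hz t ht
    -- The energy relation in polar form, homogeneous so that it holds without dividing by `x² +
    -- y²`.
    have h3 : orbitForm b₀ b₁ (ψ t) * (M t 0 ^ 2 + M t 1 ^ 2) = b₁ * M t 0 ^ 2 + b₀ * M t 1 ^ 2 := by
      rw [hx t ht, hy t ht, orbitForm]
      linear_combination (r t) ^ 2 *
        (b₀ * Real.cos (ψ t) ^ 2 + b₁ * Real.sin (ψ t) ^ 2) * Real.sin_sq_add_cos_sq (ψ t)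
    simp only [cross_apply, Matrix.cons_val, Pi.mul_apply, hk0, hk1]
    linear_combination (-(a + orbitForm b₀ b₁ (ψ t)) * (M t 0 ^ 2 + M t 1 ^ 2)) * h2 + M t 2 * h3
  -- Only the absolute value of the increment of `ψ` is given; `ε` is its sign, arbitrary when `n =
  -- 0`.
  obtain ⟨ε, hε, hψβ⟩ : ∃ ε : ℝ, (ε = 1 ∨ ε = -1) ∧ ψ β - ψ α = ε * (n * (2 * Real.pi)) := by
    rcases abs_choice (ψ β - ψ α) with hc | hc
    · exact ⟨1, Or.inl rfl, by rw [hc] at hn; rw [hn]; ring⟩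
    · exact ⟨-1, Or.inr rfl, by rw [hc] at hn; linear_combination -hn⟩
  have hshift : ∀ F : ℝ → ℝ, ∀ c : ℝ, (∀ x, F (x + n * (2 * Real.pi)) = F x + c) →
      F (ψ β) - F (ψ α) = ε * c := by
    intro F c hF
    rcases hε with rfl | rfl
    · rw [show ψ β = ψ α + n * (2 * Real.pi) by linear_combination hψβ, hF]; ring
    · rw [show ψ α = ψ β + n * (2 * Real.pi) by linear_combination -hψβ, hF]; ring
  -- elapsed time
  have hT := orbitTime_two_pi_pos ha hb₀ hb₁ hl
  set T := orbitTime a b₀ b₁ l (2 * Real.pi)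
  -- `orbitTime` of the azimuth changes at the constant rate `-σ`.
  have htime : ε * (n * T) = -σ * (β - α) := by
    rw [← hshift (orbitTime a b₀ b₁ l) _ fun x => orbitTime_add ha hb₀ hb₁ hl x n]
    refine sub_eq_of_hasDerivWithinAt_const (f := fun t => orbitTime a b₀ b₁ l (ψ t))
      (fun t ht => ?_) β hβm
    refine ((hasDerivAt_orbitTime ha hb₀ hb₁ hl (ψ t)).comp_hasDerivWithinAt t
      (hdψ t ht)).congr_deriv ?_
    have := orbitSpeed_pos ha hb₀ hb₁ (ψ t)
    field_simp
  have hσ' : σ = 1 ∨ σ = -1 := by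
    simpa using sq_eq_sq_iff_eq_or_eq_neg.1 (hσ.trans (one_pow 2).symm)
  -- Time runs forward: the wrong sign `ε = σ` would give `n T = -(β - α)`, which forces both sides
  -- to vanish.
  have hsign : ε = -σ ∨ n = 0 ∧ β - α = 0 := by
    by_cases hc : ε = -σ
    · exact Or.inl hc
    right
    have hεσ : ε = σ := by
      rcases hε with rfl | rfl <;> rcases hσ' with rfl | rfl <;> simp_all
    have hnT : n * T = -(β - α) := by
      rw [hεσ] at htime
      have hσ0 : σ ≠ 0 := by rintro rfl; simp at hσ
      apply mul_left_cancel₀ hσ0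
      linear_combination htime
    have h1 : 0 ≤ n * T := by positivity
    have h2 : n * T = 0 := by linarith
    refine ⟨?_, by linarith⟩
    rcases mul_eq_zero.1 h2 with h3 | h3
    · exact_mod_cast h3
    · exact absurd h3 hT.ne'
  refine ⟨?_, ?_, ?_⟩
  · rcases hsign with hc | ⟨hc, hd⟩
    · have hσ0 : σ ≠ 0 := by rintro rfl; simp at hσ
      rw [hc] at htime
      apply mul_left_cancel₀ hσ0
      linear_combination htime
    · rw [hc, hd]; simp
  · have hper : ∀ F : ℝ → ℝ, Function.Periodic F (2 * Real.pi) → F (ψ β) = F (ψ α) := by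
      intro F hF
      have := hshift F 0 fun x => by rw [hF.nat_mul n x, add_zero]
      linarith
    have hr : r β = r α := by
      rw [← sq_eq_sq₀ (hr0 β hβm).le (hr0 α hαm).le, (hpol β hβm).1, (hpol α hαm).1,
        hper _ orbitForm_periodic]
    have hMβ : M β = M α := by
      ext i
      fin_cases i
      · change M β 0 = M α 0
        rw [hx β hβm, hx α hαm, hr, hper _ Real.sin_periodic]
      · change M β 1 = M α 1
        rw [hy β hβm, hy α hαm, hr, hper _ Real.cos_periodic]
      · change M β 2 = M α 2
        rw [hz β hβm, hz α hαm, hper _ orbitHeight_periodic]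
    have := congrArg (fun v => rotX P *ᵥ v) hMβ
    simpa only [hMdef, rotX_mulVec_rotX_neg] using this
  · intro ref φ href hperp hφ haz
    have hdφ : ∀ t ∈ Icc α β, HasDerivWithinAt φ (l * (k 2 - a) - l * orbitForm b₀ b₁ (ψ t))
        (Icc α β) t := by
      intro t ht
      refine hR.hasDerivWithinAt_azimuth hl hℓ href hperp hφ haz ht ?_
      have hL : (R t)ᵀ *ᵥ ℓ = rotX P *ᵥ M t := (rotX_mulVec_rotX_neg _ _).symm
      rw [h, hL, rotX_neg_mulVec_rotX, ← mulVec_crossProduct (rotX_mem P),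
        ← mulVec_crossProduct (rotX_mem P), mulVec_dotProduct_mulVec (rotX_mem P),
        mulVec_dotProduct_mulVec (rotX_mem P), mulVec_dotProduct_mulVec (rotX_mem P)]
      have h1 := hnorm t ht
      have h2 := hen t ht
      have h3 : orbitForm b₀ b₁ (ψ t) * (M t 0 ^ 2 + M t 1 ^ 2) =
          b₁ * M t 0 ^ 2 + b₀ * M t 1 ^ 2 := by
        rw [hx t ht, hy t ht, orbitForm]
        linear_combination (r t) ^ 2 *
          (b₀ * Real.cos (ψ t) ^ 2 + b₁ * Real.sin (ψ t) ^ 2) * Real.sin_sq_add_cos_sq (ψ t)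
      simp [cross_apply, dotProduct, Fin.sum_univ_three, hk0, hk1]
      linear_combination l * (k 2 - a - orbitForm b₀ b₁ (ψ t)) * h1 + l * h3
    have hint : ∀ x, ∫ u in (0 : ℝ)..(x + n * (2 * Real.pi)), orbitHeight a b₀ b₁ u =
        (∫ u in (0 : ℝ)..x, orbitHeight a b₀ b₁ u) +
          n * ∫ u in (0 : ℝ)..(2 * Real.pi), orbitHeight a b₀ b₁ u := fun x =>
      Function.Periodic.integral_zero_add_nat_mul hhc orbitHeight_periodic x n
    have hA : (∫ u in (0 : ℝ)..ψ β, orbitHeight a b₀ b₁ u) - ∫ u in (0 : ℝ)..ψ α, orbitHeight a b₀ b₁ u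
        = ε * (n * ∫ u in (0 : ℝ)..(2 * Real.pi), orbitHeight a b₀ b₁ u) :=
      hshift (fun x => ∫ u in (0 : ℝ)..x, orbitHeight a b₀ b₁ u) _ hint
    -- Subtracting `σ ∫ h dψ` removes the term `-l f` from the azimuth rate, leaving the constant
    -- dynamic rate.
    have hphase := sub_eq_of_hasDerivWithinAt_const
      (f := fun t => φ t - σ * ∫ u in (0 : ℝ)..(ψ t), orbitHeight a b₀ b₁ u) (a := α) (b := β)
      (ω := l * (k 2 - a)) (fun t ht => by
        refine ((hdφ t ht).fun_sub ((((hhc.integral_hasStrictDerivAt 0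
          (ψ t)).hasDerivAt).comp_hasDerivWithinAt t (hdψ t ht)).const_mul σ)).congr_deriv ?_
        have hb := orbitForm_pos hb₀ hb₁ (ψ t)
        have h1 := orbitHeight_sq ha hb₀ hb₁ (ψ t)
        rw [eq_div_iff (by positivity)] at h1
        rw [← orbitHeight_mul ha hb₀ hb₁]
        linear_combination l * h1 + l * orbitHeight a b₀ b₁ (ψ t) ^ 2 *
          (a + orbitForm b₀ b₁ (ψ t)) * hσ) β hβm
    rcases hsign with hc | ⟨hc, hd⟩
    · rw [hc] at hA
      linear_combination hphase + σ * hA -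
        (n * ∫ u in (0 : ℝ)..(2 * Real.pi), orbitHeight a b₀ b₁ u) * hσ
    · rw [hc] at hA ⊢
      simp only [Nat.cast_zero, zero_mul, mul_zero, sub_zero] at hA ⊢
      linear_combination hphase + σ * hA

end TwistStage

/-! ### Volume of the region under the cone -/

section SolidAngle

theorem measurableSet_setOf_and {α : Type*} [MeasurableSpace α] {p q : α → Prop}
    (hp : MeasurableSet {x | p x}) (hq : MeasurableSet {x | q x}) :
    MeasurableSet {x | p x ∧ q x} := hp.inter hq

/-- The radial integral over one direction of a slice. If `Y ≤ X` the annulus is empty and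
`ENNReal.ofReal` truncates the right side to `0`, so no order is needed. -/
theorem lintegral_annulus (X Y : ℝ) (hX : 0 < X) :
    ∫⁻ ρ in Ioi (0 : ℝ), ENNReal.ofReal ρ * {ρ : ℝ | X ≤ ρ ^ 2 ∧ ρ ^ 2 < Y}.indicator 1 ρ =
      ENNReal.ofReal ((Y - X) / 2) := by
  have hset : {ρ : ℝ | X ≤ ρ ^ 2 ∧ ρ ^ 2 < Y} ∩ Ioi 0 = Ico √X √Y := by
    ext ρ
    simp only [mem_inter_iff, mem_ofPred_eq, mem_Ioi, mem_Ico]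
    constructor
    · rintro ⟨⟨h1, h2⟩, h3⟩
      exact ⟨(Real.sqrt_le_left h3.le).2 h1, (Real.lt_sqrt h3.le).2 h2⟩
    · rintro ⟨h1, h2⟩
      have h3 : 0 < ρ := (Real.sqrt_pos.2 hX).trans_le h1
      exact ⟨⟨(Real.sqrt_le_left h3.le).1 h1, (Real.lt_sqrt h3.le).1 h2⟩, h3⟩
  have hm : MeasurableSet {ρ : ℝ | X ≤ ρ ^ 2 ∧ ρ ^ 2 < Y} :=
    measurableSet_setOf_and (measurableSet_le (by fun_prop) (by fun_prop))
      (measurableSet_lt (by fun_prop) (by fun_prop))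
  have h1 : ∀ ρ, ENNReal.ofReal ρ * {ρ : ℝ | X ≤ ρ ^ 2 ∧ ρ ^ 2 < Y}.indicator 1 ρ =
      {ρ : ℝ | X ≤ ρ ^ 2 ∧ ρ ^ 2 < Y}.indicator ENNReal.ofReal ρ := fun ρ => by
    by_cases h : ρ ∈ {ρ : ℝ | X ≤ ρ ^ 2 ∧ ρ ^ 2 < Y} <;> simp [h]
  simp_rw [h1]
  rw [lintegral_indicator hm, Measure.restrict_restrict hm, hset]
  rcases le_total Y X with h | h
  · rw [Ico_eq_empty (not_lt.2 (Real.sqrt_le_sqrt h)), ENNReal.ofReal_of_nonpos (by linarith)]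
    simp
  · have hle : √X ≤ √Y := Real.sqrt_le_sqrt h
    rw [← ofReal_integral_eq_lintegral_ofReal]
    · rw [integral_Ico_eq_integral_Ioc, ← intervalIntegral.integral_of_le hle, integral_id,
        Real.sq_sqrt hX.le, Real.sq_sqrt (hX.le.trans h)]
    · exact (continuous_id.integrableOn_Icc (a := √X) (b := √Y)).mono_set Ico_subset_Icc_self
    · refine (ae_restrict_mem measurableSet_Ico).mono fun ρ hρ => ?_
      exact (Real.sqrt_nonneg X).trans hρ.1

/-- Above height `h` the integrand is truncated to `0`, so only `(0, h]` counts: `(h - h / 3) / 2 =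
h / 3`. -/
theorem lintegral_slices (h : ℝ) (hh : 0 < h) :
    ∫⁻ z in Ioi (0 : ℝ), ENNReal.ofReal ((1 - z ^ 2 / h ^ 2) / 2) = ENNReal.ofReal (h / 3) := by
  rw [← Ioc_union_Ioi_eq_Ioi hh.le, lintegral_union measurableSet_Ioi Ioc_disjoint_Ioi_same]
  have h1 : ∫⁻ z in Ioi h, ENNReal.ofReal ((1 - z ^ 2 / h ^ 2) / 2) = 0 := by
    rw [setLIntegral_congr_fun measurableSet_Ioi (g := fun _ => 0)]
    · simp
    · intro z hz
      refine ENNReal.ofReal_of_nonpos ?_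
      have : 1 ≤ z ^ 2 / h ^ 2 := by
        rw [le_div_iff₀ (by positivity), one_mul]
        exact pow_le_pow_left₀ hh.le (le_of_lt hz) 2
      linarith
  rw [h1, add_zero, ← ofReal_integral_eq_lintegral_ofReal]
  · rw [← intervalIntegral.integral_of_le hh.le]
    congr 1
    rw [intervalIntegral.integral_div, intervalIntegral.integral_sub (by simp)
      (Continuous.intervalIntegrable (by fun_prop) _ _), intervalIntegral.integral_div, integral_pow]
    simp
    field_simp
    norm_num
  · exact (Continuous.integrableOn_Icc (a := 0) (b := h) (by fun_prop)).mono_set Ioc_subset_Icc_self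
  · refine (ae_restrict_mem measurableSet_Ioc).mono fun z hz => ?_
    have : z ^ 2 / h ^ 2 ≤ 1 := by
      rw [div_le_one (by positivity)]
      exact pow_le_pow_left₀ hz.1.le hz.2 2
    simp only [Pi.zero_apply]
    linarith

variable {a b₀ b₁ : ℝ} (ha : 0 < a) (hb₀ : 0 < b₀) (hb₁ : 0 < b₁)
include ha hb₀ hb₁

/-- In the direction `ψ` the slice is `a z² / f ≤ ρ² < 1 - z²` with `f = orbitForm b₀ b₁ ψ`, and `1
+ a / f = 1 / h²`. -/
theorem volume_slice {z : ℝ} (hz : 0 < z) :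
    volume {p : ℝ × ℝ | p.1 ^ 2 + p.2 ^ 2 + z ^ 2 < 1 ∧ a * z ^ 2 ≤ b₀ * p.1 ^ 2 + b₁ * p.2 ^ 2} =
      ∫⁻ ψ in Ioo (-Real.pi) Real.pi,
        ENNReal.ofReal ((1 - z ^ 2 / orbitHeight a b₀ b₁ ψ ^ 2) / 2) := by
  have hm : MeasurableSet {p : ℝ × ℝ | p.1 ^ 2 + p.2 ^ 2 + z ^ 2 < 1 ∧
      a * z ^ 2 ≤ b₀ * p.1 ^ 2 + b₁ * p.2 ^ 2} :=
    measurableSet_setOf_and (measurableSet_lt (by fun_prop) (by fun_prop))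
      (measurableSet_le (by fun_prop) (by fun_prop))
  rw [← lintegral_indicator_one hm, ← lintegral_comp_polarCoord_symm, polarCoord_target,
    Measure.volume_eq_prod, ← Measure.prod_restrict, lintegral_prod_symm']
  · refine lintegral_congr fun ψ => ?_
    have hb := orbitForm_pos hb₀ hb₁ ψ
    have h2 := lintegral_annulus (a * z ^ 2 / orbitForm b₀ b₁ ψ) (1 - z ^ 2) (by positivity)
    rw [orbitHeight_sq ha hb₀ hb₁]
    refine Eq.trans (lintegral_congr fun ρ => ?_) (h2.trans ?_)
    · have hiff : polarCoord.symm (ρ, ψ) ∈ {p : ℝ × ℝ | p.1 ^ 2 + p.2 ^ 2 + z ^ 2 < 1 ∧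
          a * z ^ 2 ≤ b₀ * p.1 ^ 2 + b₁ * p.2 ^ 2} ↔
          ρ ∈ {ρ : ℝ | a * z ^ 2 / orbitForm b₀ b₁ ψ ≤ ρ ^ 2 ∧ ρ ^ 2 < 1 - z ^ 2} := by
        simp only [polarCoord_symm_apply, mem_ofPred_eq, div_le_iff₀ hb]
        have e1 : (ρ * Real.cos ψ) ^ 2 + (ρ * Real.sin ψ) ^ 2 = ρ ^ 2 := by
          linear_combination ρ ^ 2 * Real.sin_sq_add_cos_sq ψ
        have e2 : b₀ * (ρ * Real.cos ψ) ^ 2 + b₁ * (ρ * Real.sin ψ) ^ 2 =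
          ρ ^ 2 * orbitForm b₀ b₁ ψ := by rw [orbitForm]; ring
        rw [e1, e2, and_comm, lt_sub_iff_add_lt]
      rw [smul_eq_mul]
      congr 1
      by_cases hρ : ρ ∈ {ρ : ℝ | a * z ^ 2 / orbitForm b₀ b₁ ψ ≤ ρ ^ 2 ∧ ρ ^ 2 < 1 - z ^ 2}
      · rw [indicator_of_mem hρ, indicator_of_mem (hiff.2 hρ)]; rfl
      · rw [indicator_of_notMem hρ, indicator_of_notMem (fun h => hρ (hiff.1 h))]
    · congr 1
      field_simp
      ring
  · refine Measurable.mul (by fun_prop) ?_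
    exact (measurable_one.indicator hm).comp continuous_polarCoord_symm.measurable

/-- The volume of the part of the unit ball between the equatorial plane and the upper half of the
cone `a z² = b₀ x² + b₁ y²`. -/
theorem volume_cone :
    volume {q : Fin 3 → ℝ | 0 < q 2 ∧ q 0 ^ 2 + q 1 ^ 2 + q 2 ^ 2 < 1 ∧
        a * q 2 ^ 2 ≤ b₀ * q 0 ^ 2 + b₁ * q 1 ^ 2} =
      ENNReal.ofReal ((∫ ψ in (0 : ℝ)..(2 * Real.pi), orbitHeight a b₀ b₁ ψ) / 3) := by
  set D : Set (ℝ × ℝ × ℝ) := {w | 0 < w.1 ∧ w.2.1 ^ 2 + w.2.2 ^ 2 + w.1 ^ 2 < 1 ∧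
    a * w.1 ^ 2 ≤ b₀ * w.2.1 ^ 2 + b₁ * w.2.2 ^ 2} with hD
  have hDm : MeasurableSet D := measurableSet_setOf_and
    (measurableSet_lt (by fun_prop) (by fun_prop)) (measurableSet_setOf_and
      (measurableSet_lt (by fun_prop) (by fun_prop)) (measurableSet_le (by fun_prop) (by fun_prop)))
  have hmp : MeasurePreserving (fun q : Fin 3 → ℝ => (q 2, (q 0, q 1))) := by
    have h1 := volume_preserving_piFinSuccAbove (fun _ : Fin 3 => ℝ) 2
    have h2 := (MeasurePreserving.id (volume : Measure ℝ)).prod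
      (volume_preserving_finTwoArrow ℝ)
    exact h2.comp h1
  have hc := continuous_orbitHeight ha hb₀ hb₁
  have hpos := orbitHeight_pos ha hb₀ hb₁
  calc _ = volume ((fun q : Fin 3 → ℝ => (q 2, (q 0, q 1))) ⁻¹' D) := rfl
    _ = volume D := hmp.measure_preimage hDm.nullMeasurableSet
    _ = ∫⁻ z, volume (Prod.mk z ⁻¹' D) := Measure.prod_apply hDm
    _ = ∫⁻ z, (Ioi 0).indicator (fun z => ∫⁻ ψ in Ioo (-Real.pi) Real.pi,
        ENNReal.ofReal ((1 - z ^ 2 / orbitHeight a b₀ b₁ ψ ^ 2) / 2)) z := by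
      refine lintegral_congr fun z => ?_
      by_cases hz : 0 < z
      · rw [indicator_of_mem (mem_Ioi.2 hz), ← volume_slice ha hb₀ hb₁ hz]
        congr 1
        ext p
        simp [hD, hz]
      · rw [indicator_of_notMem (by simpa using hz)]
        rw [show Prod.mk z ⁻¹' D = ∅ by ext p; simp [hD, hz], measure_empty]
    _ = ∫⁻ z in Ioi (0 : ℝ), ∫⁻ ψ in Ioo (-Real.pi) Real.pi,
        ENNReal.ofReal ((1 - z ^ 2 / orbitHeight a b₀ b₁ ψ ^ 2) / 2) :=
      lintegral_indicator measurableSet_Ioi _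
    -- Integrating over `z` first leaves a third of the height in each direction.
    _ = ∫⁻ ψ in Ioo (-Real.pi) Real.pi, ∫⁻ z in Ioi (0 : ℝ),
        ENNReal.ofReal ((1 - z ^ 2 / orbitHeight a b₀ b₁ ψ ^ 2) / 2) := by
      refine lintegral_lintegral_swap (Measurable.aemeasurable ?_)
      simp only [Function.uncurry_def]
      have := hc.measurable
      fun_prop
    _ = ∫⁻ ψ in Ioo (-Real.pi) Real.pi, ENNReal.ofReal (orbitHeight a b₀ b₁ ψ / 3) :=
      lintegral_congr fun ψ => lintegral_slices _ (hpos ψ)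
    _ = ENNReal.ofReal (∫ ψ in Ioo (-Real.pi) Real.pi, orbitHeight a b₀ b₁ ψ / 3) := by
      rw [ofReal_integral_eq_lintegral_ofReal]
      · exact ((hc.div_const 3).integrableOn_Icc).mono_set Ioo_subset_Icc_self
      · exact .of_forall fun ψ => (div_pos (hpos ψ) three_pos).le
    _ = _ := by
      -- Polar coordinates use angles in `(-π, π)`; periodicity moves them to `[0, 2π]`.
      rw [← integral_Ioc_eq_integral_Ioo, ← intervalIntegral.integral_of_le
        (by linarith [Real.pi_pos]), intervalIntegral.integral_div]
      have := orbitHeight_periodic (a := a) (b₀ := b₀) (b₁ := b₁) |>.intervalIntegral_add_eq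
        (-Real.pi) 0
      rw [zero_add, show -Real.pi + 2 * Real.pi = Real.pi by ring] at this
      rw [this]

end SolidAngle

/-! ### The solid angle as the integral of the height -/

section OrbitSolidAngle

variable {I : Matrix (Fin 3) (Fin 3) ℝ} {P : ℝ} {k : Fin 3 → ℝ} {a b₀ b₁ l σ : ℝ}

/-- On a sphere the first summand is constant, so comparing energies with the orbit amounts to the
sign of the quadratic form in the second. -/
theorem HasPrincipalInv.energy_eq_of_gaps (h : HasPrincipalInv I P k)
    (hk0 : k 0 = k 2 - (a + b₁)) (hk1 : k 1 = k 2 - (a + b₀)) {L M : Fin 3 → ℝ}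
    (hM : rotX (-P) *ᵥ L = M) :
    energy I L = (1 / 2) * ((k 2 - a) * (M 0 ^ 2 + M 1 ^ 2 + M 2 ^ 2) +
      (a * M 2 ^ 2 - (b₁ * M 0 ^ 2 + b₀ * M 1 ^ 2))) := by
  rw [h.energy_eq, hM]
  simp [dotProduct, Fin.sum_univ_three, hk0, hk1]
  ring

variable (ha : 0 < a) (hb₀ : 0 < b₀) (hb₁ : 0 < b₁) (hl : 0 < l)
  (hσ : σ ^ 2 = 1) (hk0 : k 0 = k 2 - (a + b₁)) (hk1 : k 1 = k 2 - (a + b₀))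
  (h : HasPrincipalInv I P k)
include ha hb₀ hb₁ hl hσ hk0 hk1 h

open scoped Pointwise in
/-- The solid angle between the equator and the orbit. -/
theorem orbitSolidAngle_eq_integral {L₀ : Fin 3 → ℝ}
    (h₀ : rotX (-P) *ᵥ L₀ = orbitPoint a b₀ b₁ l σ 0) :
    orbitSolidAngle I (rotX P *ᵥ ![0, 0, 1]) l L₀ =
      ∫ ψ in (0 : ℝ)..(2 * Real.pi), orbitHeight a b₀ b₁ ψ := by
  -- `B` sends `(x, y, z)` to `(y, -x, σ z)`: the first two coordinates match the azimuth
  -- convention, and `σ` moves the orbit's hemisphere to the upper one. Its determinant is `σ = ±1`,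
  -- so volume is preserved.
  set B : Matrix (Fin 3) (Fin 3) ℝ := !![0, 1, 0; -1, 0, 0; 0, 0, σ]
  set C : Set (Fin 3 → ℝ) := {q | 0 < q 2 ∧ q 0 ^ 2 + q 1 ^ 2 + q 2 ^ 2 < 1 ∧
    a * q 2 ^ 2 ≤ b₀ * q 0 ^ 2 + b₁ * q 1 ^ 2} with hC
  have hCm : MeasurableSet C := measurableSet_setOf_and
    (measurableSet_lt (by fun_prop) (by fun_prop)) (measurableSet_setOf_and
      (measurableSet_lt (by fun_prop) (by fun_prop)) (measurableSet_le (by fun_prop) (by fun_prop)))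
  set f : (Fin 3 → ℝ) →ₗ[ℝ] (Fin 3 → ℝ) := Matrix.toLin' (B * rotX (-P)) with hf
  have hfv : ∀ v, f v = ![(rotX (-P) *ᵥ v) 1, -(rotX (-P) *ᵥ v) 0, σ * (rotX (-P) *ᵥ v) 2] := by
    intro v
    rw [hf, Matrix.toLin'_apply, ← Matrix.mulVec_mulVec]
    generalize rotX (-P) *ᵥ v = w
    ext i
    fin_cases i <;> simp [B, Matrix.mulVec, dotProduct, Fin.sum_univ_three]
  have hdet : LinearMap.det f = σ := by
    rw [hf, LinearMap.det_toLin', Matrix.det_mul,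
      (Matrix.mem_specialOrthogonalGroup_iff.1 (rotX_mem (-P))).2, Matrix.det_fin_three]
    simp [B]
  have hσ0 : σ ≠ 0 := by rintro rfl; simp at hσ
  have hfvol : volume (f ⁻¹' C) = volume C := by
    rw [Measure.addHaar_preimage_linearMap _ (by rw [hdet]; exact hσ0), hdet]
    have : |σ⁻¹| = 1 := by
      rcases sq_eq_sq_iff_eq_or_eq_neg.1 (hσ.trans (one_pow 2).symm) with rfl | rfl <;> simp
    simp [this]
  have hfn : ∀ v, (f v) 0 ^ 2 + (f v) 1 ^ 2 + (f v) 2 ^ 2 = v ⬝ᵥ v := by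
    intro v
    rw [← mulVec_dotProduct_mulVec (rotX_mem (-P)) v v, hfv]
    simp [dotProduct, Fin.sum_univ_three]
    linear_combination (rotX (-P) *ᵥ v) 2 ^ 2 * hσ
  set s : Set (Metric.sphere (0 : EuclideanSpace ℝ (Fin 3)) 1) :=
    {u | 0 < (L₀ ⬝ᵥ (rotX P *ᵥ ![0, 0, 1])) * (WithLp.ofLp u.1 ⬝ᵥ (rotX P *ᵥ ![0, 0, 1])) ∧
      energy I (l • WithLp.ofLp u.1) ≤ energy I L₀} with hs
  have hnormsq : ∀ v : EuclideanSpace ℝ (Fin 3), WithLp.ofLp v ⬝ᵥ WithLp.ofLp v = ‖v‖ ^ 2 := by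
    intro v
    rw [EuclideanSpace.norm_sq_eq]
    simp [dotProduct, sq]
  have hmem : ∀ u : Metric.sphere (0 : EuclideanSpace ℝ (Fin 3)) 1, u ∈ s ↔
      0 < f (WithLp.ofLp u.1) 2 ∧ a * f (WithLp.ofLp u.1) 2 ^ 2 ≤
        b₀ * f (WithLp.ofLp u.1) 0 ^ 2 + b₁ * f (WithLp.ofLp u.1) 1 ^ 2 := by
    intro u
    have hu : WithLp.ofLp u.1 ⬝ᵥ WithLp.ofLp u.1 = 1 := by
      rw [hnormsq, mem_sphere_zero_iff_norm.1 u.2, one_pow]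
    change (_ ∧ _) ↔ _
    generalize WithLp.ofLp u.1 = v at hu
    have hL : L₀ ⬝ᵥ (rotX P *ᵥ ![0, 0, 1]) = σ * l * orbitHeight a b₀ b₁ 0 := by
      rw [dotProduct_comm, mulVec_dotProduct_eq, rotX_transpose, h₀]
      simp [dotProduct, Fin.sum_univ_three, orbitPoint]
    have hv : v ⬝ᵥ (rotX P *ᵥ ![0, 0, 1]) = (rotX (-P) *ᵥ v) 2 := by
      rw [dotProduct_comm, mulVec_dotProduct_eq, rotX_transpose]
      simp [dotProduct, Fin.sum_univ_three]
    obtain ⟨e1, e2⟩ := orbitPoint_zero_conserved ha hb₀ hb₁ (l := l) hσ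
    have e3 : (rotX (-P) *ᵥ v) ⬝ᵥ (rotX (-P) *ᵥ v) = 1 :=
      (mulVec_dotProduct_mulVec (rotX_mem _) v v).trans hu
    rw [hL, hv, h.energy_eq_of_gaps hk0 hk1 h₀, h.energy_eq_of_gaps hk0 hk1 rfl,
      Matrix.mulVec_smul, hfv]
    generalize rotX (-P) *ᵥ v = w at e3
    simp only [dotProduct, Fin.sum_univ_three] at e3
    simp only [Matrix.cons_val, Pi.smul_apply, smul_eq_mul]
    refine and_congr ?_ ?_
    · have := orbitHeight_pos ha hb₀ hb₁ 0
      rw [show σ * l * orbitHeight a b₀ b₁ 0 * w 2 = (l * orbitHeight a b₀ b₁ 0) * (σ * w 2) by ring,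
        mul_pos_iff_of_pos_left (by positivity)]
    · rw [e1, e2, sub_self, add_zero,
        show (l * w 0) ^ 2 + (l * w 1) ^ 2 + (l * w 2) ^ 2 = l ^ 2 by linear_combination l ^ 2 * e3,
        show a * (l * w 2) ^ 2 - (b₁ * (l * w 0) ^ 2 + b₀ * (l * w 1) ^ 2) =
          l ^ 2 * (a * w 2 ^ 2 - (b₁ * w 0 ^ 2 + b₀ * w 1 ^ 2)) by ring,
        show a * (σ * w 2) ^ 2 = a * w 2 ^ 2 by linear_combination a * w 2 ^ 2 * hσ, neg_sq]
      have hl2 : 0 < l ^ 2 := by positivity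
      constructor
      · intro h1
        have h2 : l ^ 2 * (a * w 2 ^ 2 - (b₁ * w 0 ^ 2 + b₀ * w 1 ^ 2)) ≤ 0 := by linarith
        have := nonpos_of_mul_nonpos_right h2 hl2
        linarith
      · intro h1
        have := mul_nonpos_of_nonneg_of_nonpos hl2.le
          (show a * w 2 ^ 2 - (b₁ * w 0 ^ 2 + b₀ * w 1 ^ 2) ≤ 0 by linarith)
        linarith
  have hsm : MeasurableSet s := by
    have hg : Continuous fun u : Metric.sphere (0 : EuclideanSpace ℝ (Fin 3)) 1 =>
        f (WithLp.ofLp u.1) :=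
      (LinearMap.continuous_of_finiteDimensional f).comp
        ((PiLp.continuous_ofLp 2 _).comp continuous_subtype_val)
    have hgi := fun i => ((continuous_apply i).comp hg).measurable
    simp only [Function.comp_def] at hgi
    rw [Set.ext hmem]
    exact measurableSet_setOf_and (measurableSet_lt (by fun_prop) (hgi 2))
      (measurableSet_le (((hgi 2).pow_const 2).const_mul a)
        ((((hgi 0).pow_const 2).const_mul b₀).add (((hgi 1).pow_const 2).const_mul b₁)))
  -- The conditions defining `s` are homogeneous, so the open cone over `s` is the preimage of `C`.
  -- The measure of `s` is three times the volume of that cone, which cancels the `1 / 3` in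
  -- `volume_cone`.
  have hcone : Ioo (0 : ℝ) 1 • ((↑) '' s : Set (EuclideanSpace ℝ (Fin 3))) =
      WithLp.ofLp ⁻¹' (f ⁻¹' C) := by
    ext v
    have hfv2 := hfn (WithLp.ofLp v)
    rw [hnormsq] at hfv2
    constructor
    · rintro ⟨r, hr, _, ⟨u, hu, rfl⟩, rfl⟩
      obtain ⟨h1, h2⟩ := (hmem u).1 hu
      have hnu : ‖r • (u : EuclideanSpace ℝ (Fin 3))‖ = r := by
        rw [norm_smul, mem_sphere_zero_iff_norm.1 u.2, mul_one, Real.norm_of_nonneg hr.1.le]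
      rw [hnu] at hfv2
      refine ⟨?_, ?_, ?_⟩
      · simp only [WithLp.ofLp_smul, map_smul, Pi.smul_apply, smul_eq_mul]
        exact mul_pos hr.1 h1
      · rw [hfv2]
        exact pow_lt_one₀ hr.1.le hr.2 two_ne_zero
      · simp only [WithLp.ofLp_smul, map_smul, Pi.smul_apply, smul_eq_mul]
        have := mul_le_mul_of_nonneg_left h2 (sq_nonneg r)
        linarith
    · rintro ⟨h1, h2, h3⟩
      rw [hfv2] at h2
      have hv0 : v ≠ 0 := by
        rintro rfl
        simp at h1
      have hr : 0 < ‖v‖ := norm_pos_iff.2 hv0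
      have hr1 : ‖v‖ < 1 := by
        by_contra hc
        exact absurd h2 (not_lt.2 (one_le_pow₀ (not_lt.1 hc)))
      refine ⟨‖v‖, ⟨hr, hr1⟩, ‖v‖⁻¹ • v, ⟨⟨‖v‖⁻¹ • v, ?_⟩, ?_, rfl⟩, ?_⟩
      · rw [mem_sphere_zero_iff_norm, norm_smul, norm_inv, norm_norm, inv_mul_cancel₀ hr.ne']
      · rw [hmem]
        simp only [WithLp.ofLp_smul, map_smul, Pi.smul_apply, smul_eq_mul]
        refine ⟨mul_pos (inv_pos.2 hr) h1, ?_⟩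
        have := mul_le_mul_of_nonneg_left h3 (sq_nonneg ‖v‖⁻¹)
        linarith
      · exact smul_inv_smul₀ hr.ne' v
  have hfm : MeasurableSet (f ⁻¹' C) :=
    (LinearMap.continuous_of_finiteDimensional f).measurable hCm
  have hH : 0 ≤ ∫ ψ in (0 : ℝ)..(2 * Real.pi), orbitHeight a b₀ b₁ ψ :=
    intervalIntegral.integral_nonneg Real.two_pi_pos.le
      fun ψ _ => (orbitHeight_pos ha hb₀ hb₁ ψ).le
  rw [orbitSolidAngle, Measure.toSphere_apply' _ hsm, hcone,
    (PiLp.volume_preserving_ofLp (Fin 3)).measure_preimage hfm.nullMeasurableSet, hfvol,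
    volume_cone ha hb₀ hb₁, finrank_euclideanSpace_fin, ENNReal.toReal_mul,
    ENNReal.toReal_ofReal (by positivity)]
  simp
  ring

end OrbitSolidAngle

/-! ### Parameters of the orbit through `Lt` -/

/-- The orbit of the twisting stage in the frame of the principal axes. -/
theorem ArmDiver.exists_orbit_parameters (D : ArmDiver) {l : ℝ} (hl : 0 < l) {P : ℝ}
    {J : Fin 3 → ℝ} (hJ : D.IsPrincipal P J) (hmin : ∀ i, i ≠ 2 → J 2 < J i)
    (hE : ∀ i, i ≠ 2 → l ^ 2 / (2 * J i) < D.Et l) (htilt : |D.tilt + P| < Real.pi / 2) :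
    ∃ a b₀ b₁ σ : ℝ, 0 < a ∧ 0 < b₀ ∧ 0 < b₁ ∧ σ ^ 2 = 1 ∧ J⁻¹ 0 = J⁻¹ 2 - (a + b₁) ∧
      J⁻¹ 1 = J⁻¹ 2 - (a + b₀) ∧ HasPrincipalInv D.It P J⁻¹ ∧
      rotX (-P) *ᵥ D.Lt l = orbitPoint a b₀ b₁ l σ 0 ∧ l ^ 2 * (J⁻¹ 2 - a) = 2 * D.Et l := by
  have hI : D.It.PosDef := D.inertia_posDef _ zero_mem_Icc_pi
  have hJpos := principal_moments_pos hI hJ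
  have hinv := hasPrincipalInv hI hJ
  set c := D.tilt + P
  have hM : rotX (-P) *ᵥ D.Lt l = ![0, l * Real.cos c, -(l * Real.sin c)] := by
    rw [Lt, Matrix.mulVec_mulVec, rotX_mul, show -P + -D.tilt = -c by simp only [c]; ring]
    ext i
    fin_cases i <;>
      simp [rotX, Ls, Matrix.mulVec, dotProduct, Fin.sum_univ_three, mul_comm]
  have hcos : 0 < Real.cos c := Real.cos_pos_of_mem_Ioo (abs_lt.1 htilt)
  have hsc := Real.sin_sq_add_cos_sq c
  have hEt : 2 * D.Et l = l ^ 2 * ((J 1)⁻¹ * Real.cos c ^ 2 + (J 2)⁻¹ * Real.sin c ^ 2) := by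
    rw [Et, hinv.energy_eq, hM]
    simp [dotProduct, Fin.sum_univ_three]
    ring
  have hgap : 0 < (J 2)⁻¹ - (J 1)⁻¹ :=
    sub_pos.2 ((inv_lt_inv₀ (hJpos 1) (hJpos 2)).2 (hmin 1 (by decide)))
  have hEi : ∀ i, i ≠ 2 →
      (J i)⁻¹ < (J 1)⁻¹ * Real.cos c ^ 2 + (J 2)⁻¹ * Real.sin c ^ 2 := by
    intro i hi
    have h1 := hE i hi
    rw [div_lt_iff₀ (mul_pos two_pos (hJpos i))] at h1
    rw [inv_lt_iff_one_lt_mul₀ (hJpos i)]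
    have h2 : l ^ 2 * 1 <
        l ^ 2 * (J i * ((J 1)⁻¹ * Real.cos c ^ 2 + (J 2)⁻¹ * Real.sin c ^ 2)) := by
      linear_combination h1 + J i * hEt
    rw [mul_comm]
    exact lt_of_mul_lt_mul_left h2 (sq_nonneg l)
  -- If `sin c = 0`, the momentum would lie on the `y` principal axis, where the energy is only `l²
  -- / (2 J_y)`.
  have hsin : Real.sin c ≠ 0 := by
    intro h0
    have h1 := hEi 1 (by decide)
    rw [h0] at h1 hsc
    have : Real.cos c ^ 2 = 1 := by linarith
    rw [this] at h1
    simp at h1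
  obtain ⟨σ, hσ, hσs⟩ : ∃ σ : ℝ, σ ^ 2 = 1 ∧ σ * |Real.sin c| = -Real.sin c := by
    rcases lt_or_gt_of_ne hsin with h | h
    · exact ⟨1, by norm_num, by rw [abs_of_neg h, one_mul]⟩
    · exact ⟨-1, by norm_num, by rw [abs_of_pos h, neg_one_mul]⟩
  set g := (J 2)⁻¹ - (J 1)⁻¹ with hg
  -- Since `2 Et / l² = cos² c / J_y + sin² c / J_z`, these are the gaps between `2 Et / l²` and the
  -- reciprocal moments. As `cos c > 0`, the orbit starts at azimuth `0`.
  refine ⟨g * Real.cos c ^ 2, g * Real.sin c ^ 2,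
    (J 1)⁻¹ * Real.cos c ^ 2 + (J 2)⁻¹ * Real.sin c ^ 2 - (J 0)⁻¹, σ, by positivity,
    by positivity, sub_pos.2 (hEi 0 (by decide)), hσ, ?_, ?_, hinv, ?_, ?_⟩
  · simp only [Pi.inv_apply, hg]
    linear_combination (J 2)⁻¹ * hsc
  · simp only [Pi.inv_apply, hg]
    linear_combination ((J 2)⁻¹ - (J 1)⁻¹) * hsc
  · have hsum : g * Real.cos c ^ 2 + g * Real.sin c ^ 2 = g := by linear_combination g * hsc
    have hg0 : √g ≠ 0 := by positivity
    rw [hM]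
    ext i
    fin_cases i
    · simp [orbitPoint]
    · simp [orbitPoint, orbitForm, hsum, Real.sqrt_mul hgap.le, Real.sqrt_sq hcos.le]
      field_simp
    · simp [orbitPoint, orbitHeight, orbitForm, hsum, Real.sqrt_mul hgap.le, Real.sqrt_sq_eq_abs]
      field_simp
      linear_combination -hσs
  · rw [hEt, Pi.inv_apply, hg]
    linear_combination -l ^ 2 * (J 2)⁻¹ * hsc

end TwistingSomersault

/-! ### Assembling the dive -/

open TwistingSomersault in
theorem mainTheorem9 (D : TwistingSomersault.ArmDiver) (l : ℝ) (hl : 0 < l)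
    (P : ℝ) (J : Fin 3 → ℝ) (hJ : D.IsPrincipal P J)
    -- the twist axis is the principal axis with the smallest moment of inertia
    (hmin : ∀ i, i ≠ 2 → J 2 < J i)
    -- the twisting orbit encircles that axis: its energy is above that of the equator
    (hE : ∀ i, i ≠ 2 → l ^ 2 / (2 * J i) < D.Et l)
    (htilt : |D.tilt + P| < Real.pi / 2)
    (d : TwistingSomersault.KickDive D l) (m : ℝ) (n : ℕ)
    (hm : d.HasSomersaults P m) (hn : d.HasTwists P n) :
    2 * Real.pi * m + n * D.S P l
        = d.Tair * (2 * D.Es l / l) + 2 * n * (l * D.Tt l) * ((D.Et l - D.Es l) / l ^ 2) ∧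
      d.τ₃ = n * D.Tt l ∧
      d.Tair - d.τ₃ = d.τ₁ + d.τ₅ ∧ 0 ≤ d.τ₁ + d.τ₅ := by
  obtain ⟨a, b₀, b₁, σ, ha, hb₀, hb₁, hσ, hk0, hk1, hinv, h₀, hen⟩ :=
    D.exists_orbit_parameters hl hJ hmin hE htilt
  have hTt : D.Tt l = orbitTime a b₀ b₁ l (2 * Real.pi) :=
    eulerPeriod_eq_orbitTime ha hb₀ hb₁ hl hσ hk0 hk1 hinv h₀
  have hS : D.S P l = ∫ ψ in (0 : ℝ)..(2 * Real.pi), orbitHeight a b₀ b₁ ψ :=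
    orbitSolidAngle_eq_integral ha hb₀ hb₁ hl hσ hk0 hk1 hinv h₀
  have hτ₁ := d.τ₁_nonneg
  have hτ₃ := d.τ₃_nonneg
  have hτ₅ := d.τ₅_nonneg
  have hR0 := (d.stage₁ 0 ⟨le_rfl, hτ₁⟩).1
  have hℓ : d.ℓ ⬝ᵥ d.ℓ = l ^ 2 := by
    rw [← mulVec_transpose_mulVec hR0 d.ℓ, mulVec_dotProduct_mulVec hR0, d.start]
    simp [ArmDiver.Ls, dotProduct, Fin.sum_univ_three, sq]
  have href : (d.R₁ 0 *ᵥ ![0, 0, 1]) ⬝ᵥ (d.R₁ 0 *ᵥ ![0, 0, 1]) = 1 := by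
    rw [mulVec_dotProduct_mulVec hR0]
    simp [dotProduct, Fin.sum_univ_three]
  have hperp : (d.R₁ 0 *ᵥ ![0, 0, 1]) ⬝ᵥ d.ℓ = 0 := by
    rw [mulVec_dotProduct_eq, d.start]
    simp [ArmDiver.Ls, dotProduct, Fin.sum_univ_three]
  obtain ⟨φ, hφ, hφ₁, hφ₃, hφ₅, hφm⟩ := hm
  obtain ⟨ψ, hψ, hψaz, hψn⟩ := hn
  have hTair : d.Tair = d.τ₁ + d.τ₃ + d.τ₅ := rfl
  rw [hTair] at hφ hφ₅ hφm ⊢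
  obtain ⟨hL₁, hA₁⟩ := D.somersault_stage hl hℓ hτ₁ d.stage₁ d.start
  -- One function `φ` serves all three stages and its value at each kick is an azimuth of both axes,
  -- so the increments telescope and the kicks add nothing.
  have hΔ₁ := hA₁ _ φ href hperp (hφ.mono (Icc_subset_Icc_right (by linarith))) hφ₁
  have hL₃ : (d.R₃ d.τ₁)ᵀ *ᵥ d.ℓ = D.Lt l := by
    rw [d.glue₂₃, d.stage₂.eq_mul_rotX, d.glue₁₂, Matrix.transpose_mul, ← Matrix.mulVec_mulVec,
      hL₁, rotX_transpose, ArmDiver.Lt]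
  obtain ⟨hτ, hL, hA₃⟩ := twist_stage ha hb₀ hb₁ hl hσ hk0 hk1 hinv hℓ
    (by linarith : d.τ₁ ≤ d.τ₁ + d.τ₃) d.stage₃ (by rw [hL₃, h₀]) hψ hψaz hψn
  have hΔ₃ := hA₃ _ φ href hperp
    (hφ.mono (Icc_subset_Icc hτ₁ (by linarith))) hφ₃
  -- Whole twists bring the momentum back to `Lt`, so the second kick undoes the first and stage 5
  -- is again pure somersault.
  have hL₅ : (d.R₅ (d.τ₁ + d.τ₃))ᵀ *ᵥ d.ℓ = D.Ls l := by
    have h1 := d.stage₄.eq_mul_rotX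
    have h2 : (d.R₃ (d.τ₁ + d.τ₃))ᵀ *ᵥ d.ℓ =
        rotX (-D.tilt) *ᵥ ((d.R₅ (d.τ₁ + d.τ₃))ᵀ *ᵥ d.ℓ) := by
      rw [← d.glue₃₄, h1, d.glue₄₅, Matrix.transpose_mul, ← Matrix.mulVec_mulVec, rotX_transpose]
    rw [hL, hL₃, ArmDiver.Lt] at h2
    have h3 := congrArg (fun v => rotX D.tilt *ᵥ v) h2
    simpa only [rotX_mulVec_rotX_neg] using h3.symm
  obtain ⟨-, hA₅⟩ := D.somersault_stage hl hℓ
    (by linarith : d.τ₁ + d.τ₃ ≤ d.τ₁ + d.τ₃ + d.τ₅) d.stage₅ hL₅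
  have hΔ₅ := hA₅ _ φ href hperp (hφ.mono (Icc_subset_Icc_left (by linarith))) hφ₅
  rw [add_sub_cancel_left, ← hTt] at hτ
  rw [← hS] at hΔ₃
  refine ⟨?_, hτ, by ring, by linarith⟩
  have hrate : l * (J⁻¹ 2 - a) = 2 * D.Et l / l := by
    rw [← hen]; field_simp
  rw [hrate] at hΔ₃
  have key : 2 * n * (l * D.Tt l) * ((D.Et l - D.Es l) / l ^ 2) =
      n * D.Tt l * (2 * D.Et l / l - 2 * D.Es l / l) := by field_simp
  rw [key, ← hτ]
  linear_combination hΔ₁ + hΔ₃ + hΔ₅ - hφm
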